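/- Conventions. A graded manifold $\mathcal M$ is a second countable Hausdorff smooth manifold (its body) with a sheaf of graded-commutative real algebras which is locally freely generated, over the smooth functions of the body (the functions of degree $0$), by finitely many coordinates of fixed positive degrees; morphisms are degree preserving. $\mathcal D^k(\mathcal M)$ denotes the vector fields of degree $k$, i.e. the graded derivations of degree $k$ of the sheaf of functions, with the graded commutator $[\cdot,\cdot]$. A Q-manifold $(\mathcal M,Q)$ is a graded manifold with $Q\in\mathcal D^1(\mathcal M)$, $Q^2=0$; put $ad_Q(X)=[Q,X]$ and $[X,Y]_Q=[[X,Q],Y]$ (the derived bracket). $\Omega(\mathcal M)=C^\infty(T[1]\mathcal M)$ is the algebra of differential forms, generated by the functions $h$ and their differentials $\mathrm dh$ and graded-commutative for the total degree, with $\mathrm d(hh')=\mathrm dh\,h'+(-1)^{\deg h}h\,\mathrm dh'$. For a vector field $X$, $\iota_X$ is the graded derivation of $\Omega(\mathcal M)$ of degree $\deg X-1$ with $\iota_Xh=0$, $\iota_X\mathrm dh=X(h)$, and $\mathcal L_X=\iota_X\mathrm d+(-1)^{\deg X}\mathrm d\iota_X$. For a morphism of graded manifolds $\varphi:\mathcal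 M_1\to\mathcal M$ between Q-manifolds (not necessarily a Q-morphism), $f^*=f_\varphi^*:\Omega(\mathcal M)\to C^\infty(\mathcal M_1)$ is the morphism of algebras with $f^*(h)=\varphi^*(h)$ and $f^*(\mathrm dh)=Q_1\varphi^*(h)-\varphi^*(Qh)$. Statement. Let $(\mathcal M_1,Q_1)$, $(\mathcal M_2,Q_2)$ be Q-manifolds and let $\pi:\mathcal M=\mathcal M_1\times\mathcal M_2\to\mathcal M_1$ be the trivial Q-bundle, with $Q=Q_1+Q_2$. Let $\mathcal G$ be a graded Lie subalgebra of vector fields on $\mathcal M_2$ closed under the derived bracket $[\cdot,\cdot]_{Q_2}$, and let $\omega\in\Omega(\mathcal M_2)$ be $\mathcal G$-basic: $\mathcal L_\epsilon\omega=0=\mathcal L_{ad_{Q_2}(\epsilon)}\omega$ for all $\epsilon\in\mathcal G$. Let $\omega'\in\Omega(\mathcal M)$ be the pull-back of $\omega$ along the projection $\mathcal M\to\mathcal M_2$, and let $$\mathcal G'=ad_Q\big(C^\infty(\mathcal M_1,\mathcal G)\big)\cap\mathcal D^0(\mathcal M),$$ where $C^\infty(\mathcal M_1,\mathcal G)$ is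 the space of finite sums $\sum_j b^jY_j$ with $b^j\in C^\infty(\mathcal M_1)$, $Y_j\in\mathcal G$, regarded as vertical vector fields on $\mathcal M$. Let $\exp(\mathcal G')$ be the group of automorphisms of the graded manifold $\mathcal M$ generated by the time-one flows of the complete vector fields in $\mathcal G'$. Then $f^*(\omega')$ is invariant under the action of $\exp(\mathcal G')$ on sections: for every section $\varphi:\mathcal M_1\to\mathcal M$ of $\pi$ (a morphism of graded manifolds with $\pi\circ\varphi=\mathrm{Id}$) and every $\Psi\in\exp(\mathcal G')$, $\Psi\circ\varphi$ is again a section of $\pi$ and $$f_{\Psi\circ\varphi}^*(\omega')=f_\varphi^*(\omega').$$ More generally, for any (not necessarily complete) $X\in\mathcal G'$ and any smooth family of sections $\varphi_t$, $t$ in an open interval $J$, with $\frac{d}{dt}\varphi_t^*=\varphi_t^*\circ X$, the function $f_{\varphi_t}^*(\omega')$ does not depend on $t\in J$. -/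

import Mathlib

open TopologicalSpace
open scoped Manifold ContDiff

universe u

noncomputable section

theorem contDiff_intervalIntegral_param {E V : Type} [NormedAddCommGroup E] [NormedSpace ℝ E]
    [ProperSpace E] [NormedAddCommGroup V] [NormedSpace ℝ V] [CompleteSpace V]
    {K : ℝ × E → V} (hK : ContDiff ℝ ∞ K) :
    ContDiff ℝ ∞ (fun b => ∫ t in (0 : ℝ)..1, K (t, b)) := by
  rw [contDiff_infty]
  intro n
  induction n generalizing V with
  | zero =>
    rw [Nat.cast_zero, contDiff_zero]
    refine intervalIntegral.continuous_parametric_intervalIntegral_of_continuous' ?_ 0 1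
    exact hK.continuous.comp (by fun_prop : Continuous fun p : E × ℝ => (p.2, p.1))
  | succ n ih =>
    rw [Nat.cast_add, Nat.cast_one, contDiff_succ_iff_hasFDerivAt]
    have hK' : ContDiff ℝ ∞ (fun p => (fderiv ℝ K p).comp (ContinuousLinearMap.inr ℝ ℝ E)) :=
      (hK.fderiv_right (m := ∞) (by simp)).clm_comp contDiff_const
    refine ⟨_, ih hK', fun b => ?_⟩
    obtain ⟨C, hC⟩ := ((isCompact_Icc (a := (0 : ℝ)) (b := 1)).prod
      (isCompact_closedBall b 1)).exists_bound_of_continuousOn hK'.continuous.continuousOn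
    refine (intervalIntegral.hasFDerivAt_integral_of_dominated_of_fderiv_le
      (F := fun b t => K (t, b))
      (F' := fun b t => (fderiv ℝ K (t, b)).comp (ContinuousLinearMap.inr ℝ ℝ E))
      (bound := fun _ => C) (Metric.ball_mem_nhds b one_pos) ?_ ?_ ?_ ?_ ?_ ?_)
    · exact Filter.Eventually.of_forall fun x =>
        (hK.continuous.comp (by fun_prop : Continuous fun t : ℝ => (t, x))).aestronglyMeasurable
    · exact (hK.continuous.comp
        (by fun_prop : Continuous fun t : ℝ => (t, b))).intervalIntegrable _ _
    · exact (hK'.continuous.comp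
        (by fun_prop : Continuous fun t : ℝ => (t, b))).aestronglyMeasurable
    · refine Filter.Eventually.of_forall fun t ht x hx => hC (t, x) ⟨?_, Metric.ball_subset_closedBall hx⟩
      rw [Set.uIoc_of_le zero_le_one] at ht
      exact ⟨ht.1.le, ht.2⟩
    · exact intervalIntegrable_const
    · refine Filter.Eventually.of_forall fun t _ x _ => ?_
      exact ((hK.differentiable (by simp)) (t, x)).hasFDerivAt.comp x (hasFDerivAt_prodMk_right t x)

/-- Hadamard's lemma. -/
theorem exists_hadamard {m : ℕ} {F : (Fin m → ℝ) → ℝ} (hF : ContDiff ℝ ∞ F) (a : Fin m → ℝ) :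
    ∃ g : Fin m → (Fin m → ℝ) → ℝ, (∀ i, ContDiff ℝ ∞ (g i)) ∧
      (∀ i, g i a = fderiv ℝ F a (Pi.single i 1)) ∧
      ∀ b, F b = F a + ∑ i, (b i - a i) * g i b := by
  have hD : ∀ i, ContDiff ℝ ∞ (fun p : ℝ × (Fin m → ℝ) =>
      fderiv ℝ F (a + p.1 • (p.2 - a)) (Pi.single i 1)) := fun i =>
    ((hF.fderiv_right (m := ∞) (by simp)).comp (by fun_prop)).clm_apply contDiff_const
  refine ⟨fun i b => ∫ t in (0 : ℝ)..1, fderiv ℝ F (a + t • (b - a)) (Pi.single i 1),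
    fun i => contDiff_intervalIntegral_param (hD i), fun i => by simp, fun b => ?_⟩
  have hint : ∀ i, IntervalIntegrable (fun t : ℝ =>
      (b i - a i) * fderiv ℝ F (a + t • (b - a)) (Pi.single i 1)) MeasureTheory.volume 0 1 := fun i =>
    (continuous_const.mul ((hD i).continuous.comp
      (by fun_prop : Continuous fun t : ℝ => (t, b)))).intervalIntegrable _ _
  simp_rw [← intervalIntegral.integral_const_mul]
  rw [← intervalIntegral.integral_finsetSum fun i _ => hint i]
  have key : ∀ t : ℝ, HasDerivAt (fun t : ℝ => F (a + t • (b - a)))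
      (∑ i, (b i - a i) * fderiv ℝ F (a + t • (b - a)) (Pi.single i 1)) t := by
    intro t
    have h1 : HasDerivAt (fun t : ℝ => a + t • (b - a)) (b - a) t := by
      simpa using ((hasDerivAt_id t).smul_const (b - a)).const_add a
    have h2 := ((hF.differentiable (by simp)) (a + t • (b - a))).hasFDerivAt.comp_hasDerivAt t h1
    refine h2.congr_deriv ?_
    have hs : b - a = ∑ i, Pi.single i ((b - a) i) := (Finset.univ_sum_single (b - a)).symm
    generalize a + t • (b - a) = p
    rw [hs, map_sum]
    refine Finset.sum_congr rfl fun i _ => ?_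
    have : (Pi.single i ((b - a) i) : Fin m → ℝ) = (b i - a i) • Pi.single i 1 := by
      rw [← Pi.single_smul]; simp
    rw [this, map_smul, smul_eq_mul]
  rw [intervalIntegral.integral_eq_sub_of_hasDerivAt (fun t _ => key t)]
  · simp
  · exact (continuous_finsetSum _ fun i _ => (continuous_const.mul ((hD i).continuous.comp
      (by fun_prop : Continuous fun t : ℝ => (t, b))))).intervalIntegrable _ _

/-! ### Graded manifolds -/

/-- A sheaf of `ℤ`-graded, graded-commutative real algebras over a smooth manifold, together with
the inclusion of the smooth functions of the manifold into the functions of degree zero. -/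
structure GradedSpace where
  Body : Type u
  dim : ℕ
  [top : TopologicalSpace Body]
  [t2 : T2Space Body]
  [secondCountable : SecondCountableTopology Body]
  [charted : ChartedSpace (EuclideanSpace ℝ (Fin dim)) Body]
  [manifold : IsManifold (𝓡 dim) ∞ Body]
  /-- the functions over an open set -/
  fn : Opens Body → Type u
  [ring : ∀ U, Ring (fn U)]
  [algebra : ∀ U, Algebra ℝ (fn U)]
  /-- the homogeneous functions of a given degree -/
  grading : ∀ U, ℤ → Submodule ℝ (fn U)
  one_mem : ∀ U, (1 : fn U) ∈ grading U 0
  mul_mem : ∀ {U i j} {a b : fn U}, a ∈ grading U i → b ∈ grading U j → a * b ∈ grading U (i + j)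
  isInternal : ∀ U, DirectSum.IsInternal (grading U)
  graded_comm : ∀ {U i j} {a b : fn U}, a ∈ grading U i → b ∈ grading U j →
    a * b = (-1 : ℝ) ^ (i * j) • (b * a)
  res : ∀ {U V : Opens Body}, V ≤ U → fn U →ₐ[ℝ] fn V
  res_mem : ∀ {U V : Opens Body} (h : V ≤ U) {i} {a : fn U},
    a ∈ grading U i → res h a ∈ grading V i
  res_self : ∀ {U : Opens Body} (a : fn U), res le_rfl a = a
  res_res : ∀ {U V W : Opens Body} (h : V ≤ U) (h' : W ≤ V) (a : fn U),
    res h' (res h a) = res (h'.trans h) a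
  separated : ∀ {U : Opens Body} (a : fn U),
    (∀ x ∈ U, ∃ (V : Opens Body) (h : V ≤ U), x ∈ V ∧ res h a = 0) → a = 0
  glue : ∀ {ι : Type u} (U : ι → Opens Body) (k : ℤ) (s : ∀ i, fn (U i)),
    (∀ i, s i ∈ grading (U i) k) →
    (∀ i j, res inf_le_left (s i) = res (inf_le_right : U i ⊓ U j ≤ U j) (s j)) →
    ∃ t ∈ grading (iSup U) k, ∀ i, res (le_iSup U i) t = s i
  /-- smooth functions on the body -/
  ofSmooth : ∀ U : Opens Body, C^∞⟮𝓡 dim, U; ℝ⟯ →ₐ[ℝ] fn U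
  ofSmooth_mem : ∀ {U : Opens Body} (c : C^∞⟮𝓡 dim, U; ℝ⟯), ofSmooth U c ∈ grading U 0
  res_ofSmooth : ∀ {U V : Opens Body} (h : V ≤ U) (c : C^∞⟮𝓡 dim, U; ℝ⟯),
    res h (ofSmooth U c) = ofSmooth V (ContMDiffMap.restrictRingHom (𝓡 dim) 𝓘(ℝ, ℝ) ℝ h c)

attribute [instance] GradedSpace.top GradedSpace.t2 GradedSpace.secondCountable
  GradedSpace.charted GradedSpace.manifold GradedSpace.ring GradedSpace.algebra

/-- Exponents of monomials in graded variables of degrees `d`: odd variables occur at most once. -/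
def MultiIndex {r : ℕ} (d : Fin r → ℤ) : Type := {I : Fin r → ℕ // ∀ i, Odd (d i) → I i ≤ 1}

namespace GradedSpace

variable (M : GradedSpace.{u})

/-- Smooth functions on an open subset of the body. -/
abbrev Sm (U : Opens M.Body) : Type u := C^∞⟮𝓡 M.dim, U; ℝ⟯

variable {M}

/-- The ordered monomial `ξ₀ ^ I₀ ξ₁ ^ I₁ ⋯`. -/
def monomial {U : Opens M.Body} {r : ℕ} {d : Fin r → ℤ} (ξ : Fin r → M.fn U)
    (I : MultiIndex d) : M.fn U :=
  (List.ofFn fun i => ξ i ^ I.1 i).prod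

/-- `ξ` is a system of graded fibre coordinates over `U`, of positive degrees `d`: over every open
subset of `U`, each function is in a unique way a polynomial in the `ξ i` with smooth functions on
the body as coefficients. -/
structure IsCoord (U : Opens M.Body) {r : ℕ} (d : Fin r → ℤ) (ξ : Fin r → M.fn U) : Prop where
  deg_pos : ∀ i, 0 < d i
  mem : ∀ i, ξ i ∈ M.grading U (d i)
  existsUnique : ∀ (V : Opens M.Body) (h : V ≤ U) (a : M.fn V),
    ∃! c : MultiIndex d →₀ M.Sm V,
      a = c.sum fun I s => M.ofSmooth V s * monomial (fun i => M.res h (ξ i)) I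

/-- The coefficients of a function with respect to graded coordinates. -/
def IsCoord.coeff {U : Opens M.Body} {r : ℕ} {d : Fin r → ℤ} {ξ : Fin r → M.fn U}
    (hξ : IsCoord U d ξ) (a : M.fn U) : MultiIndex d →₀ M.Sm U :=
  (hξ.existsUnique U le_rfl a).choose

end GradedSpace

/-- A (non-negatively) graded manifold: a sheaf of graded-commutative algebras on a smooth manifold
which is locally freely generated, over the smooth functions, by finitely many coordinates of fixed
positive degrees. -/
structure GradedManifold extends GradedSpace.{u} where
  rank : ℕ
  deg : Fin rank → ℤ
  exists_coord : ∀ x : Body, ∃ U : Opens Body, x ∈ U ∧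
    ∃ ξ : Fin rank → fn U, GradedSpace.IsCoord (M := toGradedSpace) U deg ξ

namespace GradedManifold

/-- The algebra `C^∞(M)` of global functions. -/
abbrev Fn (M : GradedManifold.{u}) : Type u := M.fn ⊤

/-- Global functions of degree `i`. -/
abbrev Homog (M : GradedManifold.{u}) (i : ℤ) : Submodule ℝ M.Fn := M.grading ⊤ i

/-- A smooth function on the body as a global function of degree zero. -/
def smooth (M : GradedManifold.{u}) (c : M.Sm ⊤) : M.Homog 0 := ⟨M.ofSmooth ⊤ c, M.ofSmooth_mem c⟩

end GradedManifold

/-- A morphism of graded manifolds: a smooth map of the bodies and a degree preserving pull-back of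
functions over it. The pull-back of a function on `U` is given on every open `V` that is mapped
into `U`, compatibly with restriction on both sides. -/
@[ext]
structure GMor (M N : GradedManifold.{u}) where
  base : M.Body → N.Body
  contMDiff_base : ContMDiff (𝓡 M.dim) (𝓡 N.dim) ∞ base
  pull : ∀ (U : Opens N.Body) (V : Opens M.Body), (∀ x ∈ V, base x ∈ U) → N.fn U →ₐ[ℝ] M.fn V
  pull_mem : ∀ {U : Opens N.Body} {V : Opens M.Body} (h : ∀ x ∈ V, base x ∈ U) {i : ℤ}
    {a : N.fn U}, a ∈ N.grading U i → pull U V h a ∈ M.grading V i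
  pull_res : ∀ {U U' : Opens N.Body} {V : Opens M.Body} (hU : U' ≤ U)
    (h' : ∀ x ∈ V, base x ∈ U') (h : ∀ x ∈ V, base x ∈ U) (a : N.fn U),
    pull U' V h' (N.res hU a) = pull U V h a
  res_pull : ∀ {U : Opens N.Body} {V V' : Opens M.Body} (hV : V' ≤ V)
    (h : ∀ x ∈ V, base x ∈ U) (h' : ∀ x ∈ V', base x ∈ U) (a : N.fn U),
    M.res hV (pull U V h a) = pull U V' h' a
  pull_ofSmooth : ∀ {U : Opens N.Body} {V : Opens M.Body} (h : ∀ x ∈ V, base x ∈ U)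
    (c : N.Sm U) (c' : M.Sm V), (∀ x : V, c' x = c ⟨base x.1, h x.1 x.2⟩) →
    pull U V h (N.ofSmooth U c) = M.ofSmooth V c'

namespace GMor

variable {L M N : GradedManifold.{u}}

/-- The preimage of an open set under the map of bodies. -/
def pre (φ : GMor M N) (U : Opens N.Body) : Opens M.Body :=
  ⟨φ.base ⁻¹' U, U.isOpen.preimage φ.contMDiff_base.continuous⟩

theorem base_mem (φ : GMor M N) (U : Opens N.Body) : ∀ x ∈ φ.pre U, φ.base x ∈ U := fun _ h => h

theorem mem_pre (ψ : GMor M N) {φ : GMor L M} {U : Opens N.Body} {V : Opens L.Body}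
    (h : ∀ x ∈ V, (ψ.base ∘ φ.base) x ∈ U) : ∀ x ∈ V, φ.base x ∈ ψ.pre U := h

/-- Composition of smooth functions on open subsets of the body with the map of bodies. -/
def pullSm (φ : GMor M N) {U : Opens N.Body} {V : Opens M.Body} (h : ∀ x ∈ V, φ.base x ∈ U)
    (c : N.Sm U) : M.Sm V :=
  ⟨fun x => c ⟨φ.base x.1, h x.1 x.2⟩, c.contMDiff.comp <|
    (ContMDiff.subtypeVal_comp_iff U _).1 (φ.contMDiff_base.comp contMDiff_subtype_val)⟩

/-- Pull-back of global functions. -/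
def pullTop (φ : GMor M N) : N.Fn →ₐ[ℝ] M.Fn := φ.pull ⊤ ⊤ fun _ _ => Opens.mem_top _

/-- The identity morphism. -/
def id (M : GradedManifold.{u}) : GMor M M where
  base x := x
  contMDiff_base := contMDiff_id
  pull _ _ h := M.res h
  pull_mem h _ _ ha := M.res_mem h ha
  pull_res hU h _ a := M.res_res hU h a
  res_pull hV h _ a := M.res_res h hV a
  pull_ofSmooth h c c' hc := by
    rw [M.res_ofSmooth h]
    congr 1
    exact ContMDiffMap.ext fun x => (hc x).symm

/-- Composition of morphisms: `ψ.comp φ` is `ψ ∘ φ`. -/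
def comp (ψ : GMor M N) (φ : GMor L M) : GMor L N where
  base := ψ.base ∘ φ.base
  contMDiff_base := ψ.contMDiff_base.comp φ.contMDiff_base
  pull U V h := (φ.pull (ψ.pre U) V (ψ.mem_pre h)).comp (ψ.pull U (ψ.pre U) (ψ.base_mem U))
  pull_mem h _ _ ha := φ.pull_mem _ (ψ.pull_mem _ ha)
  pull_res {U U' V} hU h' h a := by
    have e : ψ.pre U' ≤ ψ.pre U := fun x hx => hU hx
    simp only [AlgHom.comp_apply]
    rw [ψ.pull_res hU (ψ.base_mem U') (fun x hx => hU hx), ← ψ.res_pull e (ψ.base_mem U),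
      φ.pull_res e]
  res_pull hV h h' a := φ.res_pull hV _ _ _
  pull_ofSmooth {U V} h c c' hc := by
    simp only [AlgHom.comp_apply]
    rw [ψ.pull_ofSmooth _ c (ψ.pullSm (ψ.base_mem U) c) fun _ => rfl]
    exact φ.pull_ofSmooth _ _ c' hc

end GMor

/-! ### Vector fields -/

/-- Families of linear operators on the functions over all open sets. -/
abbrev Op (M : GradedManifold.{u}) : Type u := ∀ U : Opens M.Body, M.fn U →ₗ[ℝ] M.fn U

/-- `X` is a graded derivation of degree `k` of the sheaf of functions. -/
structure IsGradedDerivation {M : GradedManifold.{u}} (k : ℤ) (X : Op M) : Prop where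
  res : ∀ {U V : Opens M.Body} (h : V ≤ U) (a : M.fn U), M.res h (X U a) = X V (M.res h a)
  mem : ∀ {U : Opens M.Body} {i : ℤ} {a : M.fn U},
    a ∈ M.grading U i → X U a ∈ M.grading U (i + k)
  leibniz : ∀ {U : Opens M.Body} {i : ℤ} {a : M.fn U} (b : M.fn U), a ∈ M.grading U i →
    X U (a * b) = X U a * b + (-1 : ℝ) ^ (k * i) • (a * X U b)

/-- The space of vector fields of degree `k`. -/
def VF (M : GradedManifold.{u}) (k : ℤ) : Submodule ℝ (Op M) where
  carrier := {X | IsGradedDerivation k X}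
  add_mem' {X Y} hX hY :=
    { res := fun h a => by simp [hX.res, hY.res]
      mem := fun ha => add_mem (hX.mem ha) (hY.mem ha)
      leibniz := fun b ha => by
        simp only [Pi.add_apply, LinearMap.add_apply, hX.leibniz b ha, hY.leibniz b ha, mul_add,
          add_mul, smul_add]
        abel }
  zero_mem' :=
    { res := fun h a => by simp
      mem := fun ha => zero_mem _
      leibniz := fun b ha => by simp }
  smul_mem' r X hX :=
    { res := fun h a => by simp [hX.res]
      mem := fun ha => Submodule.smul_mem _ _ (hX.mem ha)
      leibniz := fun b ha => by
        simp only [Pi.smul_apply, LinearMap.smul_apply, hX.leibniz b ha, smul_add, smul_mul_assoc,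
          mul_smul_comm, smul_comm r] }

/-- Signs multiply and only depend on parity. -/
theorem neg_one_zpow_mul (i j : ℤ) : (-1 : ℝ) ^ i * (-1 : ℝ) ^ j = (-1 : ℝ) ^ (i + j) :=
  (zpow_add₀ (by norm_num) i j).symm

theorem neg_one_zpow_congr {i j : ℤ} (h : Even (i - j)) : (-1 : ℝ) ^ i = (-1 : ℝ) ^ j := by
  have : i = (i - j) + j := by ring
  rw [this, ← neg_one_zpow_mul, h.neg_one_zpow, one_mul]

namespace VF

variable {M : GradedManifold.{u}}

/-- The graded commutator of vector fields. -/
def bracket {k l : ℤ} (X : VF M k) (Y : VF M l) : VF M (k + l) :=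
  ⟨fun U => X.1 U ∘ₗ Y.1 U - (-1 : ℝ) ^ (k * l) • (Y.1 U ∘ₗ X.1 U),
    { res := fun h a => by simp [X.2.res, Y.2.res]
      mem := fun {U i a} ha => by
        have h1 := X.2.mem (Y.2.mem ha)
        have h2 := Y.2.mem (X.2.mem ha)
        rw [show i + l + k = i + (k + l) by ring] at h1
        rw [show i + k + l = i + (k + l) by ring] at h2
        exact sub_mem h1 (Submodule.smul_mem _ _ h2)
      leibniz := fun {U i a} b ha => by
        simp only [LinearMap.sub_apply, LinearMap.smul_apply, LinearMap.comp_apply,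
          X.2.leibniz b ha, Y.2.leibniz b ha, map_add, map_smul, X.2.leibniz _ (Y.2.mem ha),
          Y.2.leibniz _ (X.2.mem ha), X.2.leibniz _ ha, Y.2.leibniz _ ha, smul_add, smul_sub,
          mul_sub, sub_mul, smul_smul, neg_one_zpow_mul, smul_mul_assoc, mul_smul_comm]
        rw [neg_one_zpow_congr (i := k * l + l * (i + k)) (j := l * i) ⟨k * l, by ring⟩,
          neg_one_zpow_congr (i := k * (i + l)) (j := k * l + k * i) ⟨0, by ring⟩,
          neg_one_zpow_congr (i := l * i + k * i) (j := (k + l) * i) ⟨0, by ring⟩,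
          neg_one_zpow_congr (i := k * l + (k * i + l * i)) (j := (k + l) * i + k * l)
            ⟨0, by ring⟩]
        abel }⟩

/-- Vector fields annihilate constants. -/
theorem map_one {k : ℤ} (X : VF M k) (U : Opens M.Body) : X.1 U 1 = 0 := by
  have := X.2.leibniz (U := U) 1 (M.one_mem U)
  simpa using this

end VF

namespace GradedManifold

variable {M : GradedManifold.{u}}

/-- A function which, at every point of the body, is a combination of functions with coefficients
vanishing at that point is zero. -/
theorem eq_zero_of_vanish (a : M.Fn)
    (h : ∀ x : M.Body, ∃ (m : ℕ) (c : Fin m → M.Sm ⊤) (e : Fin m → M.Fn),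
      (∀ j, c j ⟨x, Opens.mem_top x⟩ = 0) ∧ a = ∑ j, M.ofSmooth ⊤ (c j) * e j) : a = 0 := by
  refine M.separated a fun x _ => ?_
  obtain ⟨U, hxU, ξ, hξ⟩ := M.exists_coord x
  refine ⟨U, le_top, hxU, ?_⟩
  obtain ⟨s, hs, huniq⟩ := hξ.existsUnique U le_rfl (M.res le_top a)
  suffices s = 0 by rw [hs, this]; simp
  ext I y
  obtain ⟨m, c, e, hc, hce⟩ := h y.1
  choose t ht _ using fun j => hξ.existsUnique U le_rfl (M.res le_top (e j))
  let r := ContMDiffMap.restrictRingHom (n := ∞) (𝓡 M.dim) 𝓘(ℝ, ℝ) ℝ (le_top : U ≤ ⊤)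
  have key : s = ∑ j, r (c j) • t j := by
    refine (huniq _ ?_).symm
    dsimp only
    rw [hce, map_sum, ← Finsupp.sum_finsetSum_index (by simp) (by simp [add_mul])]
    refine Finset.sum_congr rfl fun j _ => ?_
    rw [map_mul, M.res_ofSmooth, ht j, Finsupp.sum_smul_index' (by simp), Finsupp.mul_sum]
    simp [r, mul_assoc]
  have ev : ∀ f g : M.Sm U, (f * g) y = f y * g y := fun _ _ => rfl
  have evs : ∀ f : Fin m → M.Sm U, (∑ j, f j) y = ∑ j, f j y := fun f =>
    map_sum (ContMDiffMap.evalRingHom (n := ∞) (I := 𝓡 M.dim) (I' := 𝓘(ℝ, ℝ)) (R := ℝ) y) f _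
  rw [key, Finsupp.finsetSum_apply, evs]
  refine Finset.sum_eq_zero fun j _ => ?_
  rw [Finsupp.smul_apply, smul_eq_mul, ev]
  have : r (c j) y = 0 := hc j
  rw [this, zero_mul]

/-- `g = F(h₁, …, hₘ)` for a smooth function `F`, with `p i` the value of the `i`-th partial
derivative of `F` at `(h₁, …, hₘ)`. -/
structure IsSmoothComp {m : ℕ} (F : (Fin m → ℝ) → ℝ) (h : Fin m → M.Sm ⊤) (g : M.Sm ⊤)
    (p : Fin m → M.Sm ⊤) : Prop where
  contDiff : ContDiff ℝ ∞ F
  eq : ∀ x, g x = F fun i => h i x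
  partial_eq : ∀ i x, p i x = fderiv ℝ F (fun i => h i x) (Pi.single i 1)

/-- Composition of smooth functions on the body with a smooth function of several variables. -/
def smComp {m : ℕ} {F : (Fin m → ℝ) → ℝ} (hF : ContDiff ℝ ∞ F) (h : Fin m → M.Sm ⊤) : M.Sm ⊤ :=
  ⟨fun x => F fun i => h i x,
    hF.contMDiff.comp (contMDiff_pi_space.2 fun i => (h i).contMDiff)⟩

/-- The chain rule for vector fields. -/
theorem IsSmoothComp.vf_apply {m : ℕ} {F : (Fin m → ℝ) → ℝ} {h : Fin m → M.Sm ⊤} {g : M.Sm ⊤}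
    {p : Fin m → M.Sm ⊤} (H : IsSmoothComp F h g p) {k : ℤ} (X : VF M k) :
    X.1 ⊤ (M.ofSmooth ⊤ g) = ∑ i, M.ofSmooth ⊤ (p i) * X.1 ⊤ (M.ofSmooth ⊤ (h i)) := by
  have leib : ∀ c d : M.Sm ⊤, X.1 ⊤ (M.ofSmooth ⊤ (c * d)) =
      M.ofSmooth ⊤ d * X.1 ⊤ (M.ofSmooth ⊤ c) + M.ofSmooth ⊤ c * X.1 ⊤ (M.ofSmooth ⊤ d) := by
    intro c d
    rw [map_mul, X.2.leibniz _ (M.ofSmooth_mem c),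
      M.graded_comm (X.2.mem (M.ofSmooth_mem c)) (M.ofSmooth_mem d)]
    simp
  have hconst : ∀ r : ℝ, X.1 ⊤ (M.ofSmooth ⊤ (algebraMap ℝ (M.Sm ⊤) r)) = 0 := by
    intro r
    rw [AlgHom.commutes, Algebra.algebraMap_eq_smul_one, map_smul, VF.map_one X, smul_zero]
  rw [← sub_eq_zero]
  refine eq_zero_of_vanish _ fun x => ?_
  let x' : (⊤ : Opens M.Body) := ⟨x, Opens.mem_top x⟩
  obtain ⟨G, hG, hGa, hFG⟩ := exists_hadamard H.contDiff fun i => h i x'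
  let q : Fin m → M.Sm ⊤ := fun i => smComp (hG i) h
  let t : Fin m → M.Sm ⊤ := fun i => h i - algebraMap ℝ (M.Sm ⊤) (h i x')
  have hg : g = algebraMap ℝ (M.Sm ⊤) (F fun i => h i x') + ∑ i, t i * q i := by
    refine ContMDiffMap.ext fun y => ?_
    have evs : ∀ f : Fin m → M.Sm ⊤, (∑ j, f j) y = ∑ j, f j y := fun f =>
      map_sum (ContMDiffMap.evalRingHom (n := ∞) (I := 𝓡 M.dim) (I' := 𝓘(ℝ, ℝ)) (R := ℝ) y) f _
    have e1 : (algebraMap ℝ (M.Sm ⊤) (F fun i => h i x') + ∑ i, t i * q i) y =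
      (F fun i => h i x') + (∑ i, t i * q i) y := rfl
    rw [e1, evs, H.eq, hFG]
    rfl
  refine ⟨m + m, Fin.append (fun i => q i - p i) t, Fin.append
    (fun i => X.1 ⊤ (M.ofSmooth ⊤ (h i))) (fun i => X.1 ⊤ (M.ofSmooth ⊤ (q i))), ?_, ?_⟩
  · intro j
    refine Fin.addCases (fun i => ?_) (fun i => ?_) j
    · rw [Fin.append_left]
      change G i (fun i => h i x') - p i x' = 0
      rw [hGa, H.partial_eq, sub_self]
    · rw [Fin.append_right]
      change h i x' - h i x' = 0
      rw [sub_self]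
  · rw [Fin.sum_univ_add]
    simp only [Fin.append_left, Fin.append_right]
    rw [hg, map_add, map_add, hconst, zero_add, map_sum, map_sum]
    simp only [leib]
    have ht : ∀ i, X.1 ⊤ (M.ofSmooth ⊤ (t i)) = X.1 ⊤ (M.ofSmooth ⊤ (h i)) := fun i => by
      simp only [t, map_sub, hconst, sub_zero]
    simp only [ht, map_sub, sub_mul, Finset.sum_add_distrib, Finset.sum_sub_distrib]
    abel

end GradedManifold

/-! ### Differential forms -/

/-- Generators of the algebra of differential forms: the homogeneous global functions `h` and their
differentials `dh`. -/
inductive FormGen (M : GradedManifold.{u}) : Type u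
  | fn (i : ℤ) (h : M.Homog i)
  | d (i : ℤ) (h : M.Homog i)

namespace FormGen

variable {M : GradedManifold.{u}}

/-- The function `h` in the free algebra. -/
def f {i : ℤ} (h : M.Homog i) : FreeAlgebra ℝ (FormGen M) := FreeAlgebra.ι ℝ (.fn i h)

/-- The differential `dh` in the free algebra. -/
def df {i : ℤ} (h : M.Homog i) : FreeAlgebra ℝ (FormGen M) := FreeAlgebra.ι ℝ (.d i h)

end FormGen

open FormGen in
/-- The relations between functions and their differentials: the algebra relations of `C^∞(M)`,
linearity and the graded Leibniz rule for `d`, graded commutativity with respect to the total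
degree, and the chain rule for smooth functions of several functions on the body. -/
inductive FormRel (M : GradedManifold.{u}) :
    FreeAlgebra ℝ (FormGen M) → FreeAlgebra ℝ (FormGen M) → Prop
  | fn_add {i : ℤ} (a b : M.Homog i) : FormRel M (f (a + b)) (f a + f b)
  | fn_smul {i : ℤ} (r : ℝ) (a : M.Homog i) : FormRel M (f (r • a)) (r • f a)
  | fn_one (a : M.Homog 0) (h : (a : M.Fn) = 1) : FormRel M (f a) 1
  | fn_mul {i j k : ℤ} (a : M.Homog i) (b : M.Homog j) (c : M.Homog k) (hk : k = i + j)
      (h : (c : M.Fn) = a * b) : FormRel M (f c) (f a * f b)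
  | d_add {i : ℤ} (a b : M.Homog i) : FormRel M (df (a + b)) (df a + df b)
  | d_smul {i : ℤ} (r : ℝ) (a : M.Homog i) : FormRel M (df (r • a)) (r • df a)
  | d_mul {i j k : ℤ} (a : M.Homog i) (b : M.Homog j) (c : M.Homog k) (hk : k = i + j)
      (h : (c : M.Fn) = a * b) :
      FormRel M (df c) (df a * f b + (-1 : ℝ) ^ i • (f a * df b))
  | fn_d_comm {i j : ℤ} (a : M.Homog i) (b : M.Homog j) :
      FormRel M (f a * df b) ((-1 : ℝ) ^ (i * (j + 1)) • (df b * f a))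
  | d_d_comm {i j : ℤ} (a : M.Homog i) (b : M.Homog j) :
      FormRel M (df a * df b) ((-1 : ℝ) ^ ((i + 1) * (j + 1)) • (df b * df a))
  | chain {m : ℕ} {F : (Fin m → ℝ) → ℝ} {h : Fin m → M.Sm ⊤} {g : M.Sm ⊤} {p : Fin m → M.Sm ⊤}
      (H : GradedManifold.IsSmoothComp F h g p) :
      FormRel M (df (M.smooth g)) (∑ i, f (M.smooth (p i)) * df (M.smooth (h i)))

/-- The algebra `Ω(M)` of differential forms on a graded manifold, that is, `C^∞(T[1]M)`. -/
def Form (M : GradedManifold.{u}) : Type u := RingQuot (FormRel M)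

namespace Form

variable {M N : GradedManifold.{u}}

instance : Ring (Form M) := inferInstanceAs (Ring (RingQuot (FormRel M)))

instance : Algebra ℝ (Form M) := inferInstanceAs (Algebra ℝ (RingQuot (FormRel M)))

/-- The quotient map from the free algebra. -/
def mk (M : GradedManifold.{u}) : FreeAlgebra ℝ (FormGen M) →ₐ[ℝ] Form M :=
  RingQuot.mkAlgHom ℝ (FormRel M)

theorem mk_rel {x y : FreeAlgebra ℝ (FormGen M)} (h : FormRel M x y) : mk M x = mk M y :=
  RingQuot.mkAlgHom_rel ℝ h

/-- A homogeneous function as a form of order zero. -/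
def fn {i : ℤ} (h : M.Homog i) : Form M := mk M (FormGen.f h)

/-- The differential of a homogeneous function. -/
def dfn {i : ℤ} (h : M.Homog i) : Form M := mk M (FormGen.df h)

/-- Algebra morphisms out of `Ω(M)`. -/
def lift {B : Type*} [Ring B] [Algebra ℝ B] (g : FormGen M → B)
    (hg : ∀ ⦃x y⦄, FormRel M x y → FreeAlgebra.lift ℝ g x = FreeAlgebra.lift ℝ g y) :
    Form M →ₐ[ℝ] B :=
  RingQuot.liftAlgHom ℝ ⟨FreeAlgebra.lift ℝ g, hg⟩

theorem lift_mk {B : Type*} [Ring B] [Algebra ℝ B] (g : FormGen M → B)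
    (hg : ∀ ⦃x y⦄, FormRel M x y → FreeAlgebra.lift ℝ g x = FreeAlgebra.lift ℝ g y)
    (x : FreeAlgebra ℝ (FormGen M)) : lift g hg (mk M x) = FreeAlgebra.lift ℝ g x :=
  RingQuot.liftAlgHom_mkAlgHom_apply ℝ _ _ _

theorem fn_add {i : ℤ} (a b : M.Homog i) : fn (a + b) = fn a + fn b := by
  simpa [fn] using mk_rel (.fn_add a b)

theorem fn_smul {i : ℤ} (r : ℝ) (a : M.Homog i) : fn (r • a) = r • fn a := by
  simpa [fn] using mk_rel (.fn_smul r a)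

theorem fn_one (a : M.Homog 0) (h : (a : M.Fn) = 1) : fn a = 1 := by
  simpa [fn] using mk_rel (.fn_one a h)

theorem fn_mul {i j k : ℤ} (a : M.Homog i) (b : M.Homog j) (c : M.Homog k) (hk : k = i + j)
    (h : (c : M.Fn) = a * b) : fn c = fn a * fn b := by
  simpa [fn] using mk_rel (.fn_mul a b c hk h)

theorem fn_fn_comm {i j : ℤ} (a : M.Homog i) (b : M.Homog j) :
    fn a * fn b = (-1 : ℝ) ^ (i * j) • (fn b * fn a) := by
  have m1 : b.1 * a.1 ∈ M.Homog (i + j) := by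
    have := M.mul_mem b.2 a.2
    rwa [add_comm] at this
  rw [← fn_mul a b ((-1 : ℝ) ^ (i * j) • ⟨_, m1⟩) rfl (M.graded_comm a.2 b.2).symm, fn_smul,
    fn_mul b a ⟨_, m1⟩ (by ring) rfl]

theorem dfn_add {i : ℤ} (a b : M.Homog i) : dfn (a + b) = dfn a + dfn b := by
  simpa [dfn] using mk_rel (.d_add a b)

theorem dfn_smul {i : ℤ} (r : ℝ) (a : M.Homog i) : dfn (r • a) = r • dfn a := by
  simpa [dfn] using mk_rel (.d_smul r a)

theorem dfn_mul {i j k : ℤ} (a : M.Homog i) (b : M.Homog j) (c : M.Homog k) (hk : k = i + j)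
    (h : (c : M.Fn) = a * b) : dfn c = dfn a * fn b + (-1 : ℝ) ^ i • (fn a * dfn b) := by
  simpa [fn, dfn] using mk_rel (.d_mul a b c hk h)

theorem fn_dfn_comm {i j : ℤ} (a : M.Homog i) (b : M.Homog j) :
    fn a * dfn b = (-1 : ℝ) ^ (i * (j + 1)) • (dfn b * fn a) := by
  simpa [fn, dfn] using mk_rel (.fn_d_comm a b)

theorem dfn_dfn_comm {i j : ℤ} (a : M.Homog i) (b : M.Homog j) :
    dfn a * dfn b = (-1 : ℝ) ^ ((i + 1) * (j + 1)) • (dfn b * dfn a) := by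
  simpa [fn, dfn] using mk_rel (.d_d_comm a b)

theorem dfn_chain {m : ℕ} {F : (Fin m → ℝ) → ℝ} {h : Fin m → M.Sm ⊤} {g : M.Sm ⊤}
    {p : Fin m → M.Sm ⊤} (H : GradedManifold.IsSmoothComp F h g p) :
    dfn (M.smooth g) = ∑ i, fn (M.smooth (p i)) * dfn (M.smooth (h i)) := by
  simpa [fn, dfn] using mk_rel (.chain H)

/-- The values `D₀ h` and `D₁ h` on the generators `h` and `dh` of a graded derivation of degree `k`
of `Ω(M)`. -/
structure IsDerData (k : ℤ) (D₀ D₁ : ∀ i : ℤ, M.Homog i → Form M) : Prop where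
  fn_add : ∀ {i : ℤ} (a b : M.Homog i), D₀ i (a + b) = D₀ i a + D₀ i b
  fn_smul : ∀ {i : ℤ} (r : ℝ) (a : M.Homog i), D₀ i (r • a) = r • D₀ i a
  fn_one : ∀ a : M.Homog 0, (a : M.Fn) = 1 → D₀ 0 a = 0
  fn_mul : ∀ {i j l : ℤ} (a : M.Homog i) (b : M.Homog j) (c : M.Homog l), l = i + j →
    (c : M.Fn) = a * b → D₀ l c = D₀ i a * fn b + (-1 : ℝ) ^ (k * i) • (fn a * D₀ j b)
  d_add : ∀ {i : ℤ} (a b : M.Homog i), D₁ i (a + b) = D₁ i a + D₁ i b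
  d_smul : ∀ {i : ℤ} (r : ℝ) (a : M.Homog i), D₁ i (r • a) = r • D₁ i a
  d_mul : ∀ {i j l : ℤ} (a : M.Homog i) (b : M.Homog j) (c : M.Homog l), l = i + j →
    (c : M.Fn) = a * b → D₁ l c = D₁ i a * fn b + (-1 : ℝ) ^ (k * (i + 1)) • (dfn a * D₀ j b) +
      (-1 : ℝ) ^ i • (D₀ i a * dfn b + (-1 : ℝ) ^ (k * i) • (fn a * D₁ j b))
  fn_d_comm : ∀ {i j : ℤ} (a : M.Homog i) (b : M.Homog j),
    D₀ i a * dfn b + (-1 : ℝ) ^ (k * i) • (fn a * D₁ j b) = (-1 : ℝ) ^ (i * (j + 1)) •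
      (D₁ j b * fn a + (-1 : ℝ) ^ (k * (j + 1)) • (dfn b * D₀ i a))
  d_d_comm : ∀ {i j : ℤ} (a : M.Homog i) (b : M.Homog j),
    D₁ i a * dfn b + (-1 : ℝ) ^ (k * (i + 1)) • (dfn a * D₁ j b) =
      (-1 : ℝ) ^ ((i + 1) * (j + 1)) •
        (D₁ j b * dfn a + (-1 : ℝ) ^ (k * (j + 1)) • (dfn b * D₁ i a))
  chain : ∀ {m : ℕ} {F : (Fin m → ℝ) → ℝ} {h : Fin m → M.Sm ⊤} {g : M.Sm ⊤} {p : Fin m → M.Sm ⊤},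
    GradedManifold.IsSmoothComp F h g p → D₁ 0 (M.smooth g) =
      ∑ i, (D₀ 0 (M.smooth (p i)) * dfn (M.smooth (h i)) +
        fn (M.smooth (p i)) * D₁ 0 (M.smooth (h i)))

/-- The matrices `[[± x, D x], [0, x]]` attached to a graded derivation `D` of degree `k`; a map `D`
is a graded derivation if and only if these matrices depend multiplicatively on `x`. -/
def derGen (k : ℤ) (D₀ D₁ : ∀ i : ℤ, M.Homog i → Form M) :
    FormGen M → Matrix (Fin 2) (Fin 2) (Form M)
  | .fn i h => !![(-1 : ℝ) ^ (k * i) • fn h, D₀ i h; 0, fn h]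
  | .d i h => !![(-1 : ℝ) ^ (k * (i + 1)) • dfn h, D₁ i h; 0, dfn h]

theorem derGen_f (k : ℤ) (D₀ D₁ : ∀ i : ℤ, M.Homog i → Form M) {i : ℤ} (h : M.Homog i) :
    FreeAlgebra.lift ℝ (derGen k D₀ D₁) (FormGen.f h) =
      !![(-1 : ℝ) ^ (k * i) • fn h, D₀ i h; 0, fn h] := by
  simp [FormGen.f, derGen]

theorem derGen_df (k : ℤ) (D₀ D₁ : ∀ i : ℤ, M.Homog i → Form M) {i : ℤ} (h : M.Homog i) :
    FreeAlgebra.lift ℝ (derGen k D₀ D₁) (FormGen.df h) =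
      !![(-1 : ℝ) ^ (k * (i + 1)) • dfn h, D₁ i h; 0, dfn h] := by
  simp [FormGen.df, derGen]

theorem derGen_rel {k : ℤ} {D₀ D₁ : ∀ i : ℤ, M.Homog i → Form M} (H : IsDerData k D₀ D₁)
    ⦃x y : FreeAlgebra ℝ (FormGen M)⦄ (h : FormRel M x y) :
    FreeAlgebra.lift ℝ (derGen k D₀ D₁) x = FreeAlgebra.lift ℝ (derGen k D₀ D₁) y := by
  have mext : ∀ {a b c a' b' c' : Form M}, a = a' → b = b' → c = c' →
      !![a, b; 0, c] = !![a', b'; 0, c'] := by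
    rintro a b c _ _ _ rfl rfl rfl
    rfl
  have mm : ∀ a b c a' b' c' : Form M,
      !![a, b; 0, c] * !![a', b'; 0, c'] = !![a * a', b * c' + a * b'; 0, c * c'] := by
    intro a b c a' b' c'
    simp [add_comm]
  have ms : ∀ (r : ℝ) (a b c : Form M), r • !![a, b; 0, c] = !![r • a, r • b; 0, r • c] := by
    intro r a b c
    simp
  have ma : ∀ a b c a' b' c' : Form M,
      !![a, b; 0, c] + !![a', b'; 0, c'] = !![a + a', b + b'; 0, c + c'] := by
    intro a b c a' b' c'
    simp
  cases h with
  | fn_add a b => simp only [map_add, derGen_f, ma, H.fn_add, fn_add, smul_add]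
  | fn_smul r a => simp only [map_smul, derGen_f, ms, H.fn_smul, fn_smul, smul_comm r]
  | fn_one a h =>
    rw [derGen_f, H.fn_one a h, fn_one a h, map_one, mul_zero, zpow_zero, one_smul,
      Matrix.one_fin_two]
  | fn_mul a b c hk h =>
    rw [map_mul, derGen_f, derGen_f, derGen_f, mm]
    refine mext ?_ ?_ (fn_mul a b c hk h)
    · rw [smul_mul_smul_comm, neg_one_zpow_mul, ← mul_add, ← hk, fn_mul a b c hk h]
    · rw [H.fn_mul a b c hk h, smul_mul_assoc]
  | d_add a b => simp only [map_add, derGen_df, ma, H.d_add, dfn_add, smul_add]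
  | d_smul r a => simp only [map_smul, derGen_df, ms, H.d_smul, dfn_smul, smul_comm r]
  | @d_mul i j l a b c hk h =>
    simp only [map_add, map_mul, map_smul, derGen_f, derGen_df, mm, ms, ma]
    refine mext ?_ ?_ (dfn_mul a b c hk h)
    · rw [dfn_mul a b c hk h, hk]
      simp only [smul_mul_assoc, mul_smul_comm, smul_smul, smul_add, neg_one_zpow_mul]
      congr 3 <;> ring
    · rw [H.d_mul a b c hk h]
      simp only [smul_mul_assoc]
  | @fn_d_comm i j a b =>
    simp only [map_mul, map_smul, derGen_f, derGen_df, mm, ms]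
    refine mext ?_ ?_ (fn_dfn_comm a b)
    · simp only [smul_mul_assoc, mul_smul_comm, smul_smul, fn_dfn_comm a b]
      congr 1
      ring
    · simp only [smul_mul_assoc, H.fn_d_comm a b]
  | @d_d_comm i j a b =>
    simp only [map_mul, map_smul, derGen_df, mm, ms]
    refine mext ?_ ?_ (dfn_dfn_comm a b)
    · simp only [smul_mul_assoc, mul_smul_comm, smul_smul]
      rw [dfn_dfn_comm a b, smul_smul]
      congr 1
      ring
    · simp only [smul_mul_assoc, H.d_d_comm a b]
  | @chain m F h g p Hc =>
    simp only [map_sum, map_mul, derGen_f, derGen_df, mm]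
    have sum_mat : ∀ u v w : Fin m → Form M, ∑ i, !![u i, v i; 0, w i] =
        !![∑ i, u i, ∑ i, v i; 0, ∑ i, w i] := by
      intro u v w
      ext a b
      rw [Matrix.sum_apply]
      fin_cases a <;> fin_cases b <;> simp
    rw [sum_mat]
    refine mext ?_ ?_ (dfn_chain Hc)
    · simp [dfn_chain Hc, Finset.smul_sum]
    · simp [H.chain Hc]

/-- The graded derivation of `Ω(M)` with given values on generators. -/
def derivation {k : ℤ} {D₀ D₁ : ∀ i : ℤ, M.Homog i → Form M} (H : IsDerData k D₀ D₁) :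
    Form M →ₗ[ℝ] Form M :=
  (Matrix.entryLinearMap ℝ (Form M) (0 : Fin 2) (1 : Fin 2)) ∘ₗ
    (lift (derGen k D₀ D₁) (derGen_rel H)).toLinearMap

theorem isDerData_d : IsDerData 1 (fun _ h => dfn (M := M) h) (fun _ _ => 0) where
  fn_add := dfn_add
  fn_smul := dfn_smul
  fn_one a h := by
    have := dfn_mul a a a (by simp) (by simp [h])
    simpa [fn_one a h] using this
  fn_mul a b c hk h := by simpa using dfn_mul a b c hk h
  d_add _ _ := by simp
  d_smul _ _ := by simp
  d_mul {i j l} a b c _ _ := by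
    rw [one_mul, zpow_add_one₀ (by norm_num)]
    simp
  fn_d_comm {i j} a b := by
    simp only [mul_zero, smul_zero, add_zero, zero_mul, zero_add, one_mul]
    rw [dfn_dfn_comm, smul_smul, neg_one_zpow_mul]
    congr 2
    ring
  d_d_comm _ _ := by simp
  chain {m F h g p} H := by
    have hF' : ∀ i, ContDiff ℝ ∞ fun y => fderiv ℝ F y (Pi.single i 1) := fun i =>
      (H.contDiff.fderiv_right (m := ∞) (by simp)).clm_apply contDiff_const
    have hF'' : ∀ i j, ContDiff ℝ ∞ fun y =>
        fderiv ℝ (fun y => fderiv ℝ F y (Pi.single i 1)) y (Pi.single j 1) := fun i j =>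
      ((hF' i).fderiv_right (m := ∞) (by simp)).clm_apply contDiff_const
    let q : Fin m → Fin m → M.Sm ⊤ := fun i j => GradedManifold.smComp (hF'' i j) h
    have hp : ∀ i, GradedManifold.IsSmoothComp (fun y => fderiv ℝ F y (Pi.single i 1)) h (p i)
        (q i) := fun i => ⟨hF' i, H.partial_eq i, fun _ _ => rfl⟩
    have hsymm : ∀ i j, q i j = q j i := by
      intro i j
      refine ContMDiffMap.ext fun x => ?_
      have hd : ∀ y, DifferentiableAt ℝ (fderiv ℝ F) y := fun y =>
        (H.contDiff.fderiv_right (m := ∞) (by simp)).differentiable (by simp) y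
      have e : ∀ (i j : Fin m) y, fderiv ℝ (fun y => fderiv ℝ F y (Pi.single i 1)) y
          (Pi.single j 1) = fderiv ℝ (fderiv ℝ F) y (Pi.single j 1) (Pi.single i 1) := by
        intro i j y
        rw [fderiv_clm_apply (hd y) (differentiableAt_const _)]
        simp
      change fderiv ℝ (fun y => fderiv ℝ F y (Pi.single i 1)) _ (Pi.single j 1) =
        fderiv ℝ (fun y => fderiv ℝ F y (Pi.single j 1)) _ (Pi.single i 1)
      rw [e, e]
      exact (H.contDiff.contDiffAt.isSymmSndFDerivAt
        (by rw [minSmoothness_of_isRCLikeNormedField]; exact WithTop.coe_le_coe.2 le_top)) _ _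
    simp only [mul_zero, add_zero]
    have hsum : ∑ i, dfn (M.smooth (p i)) * dfn (M.smooth (h i)) =
        -∑ i, dfn (M.smooth (p i)) * dfn (M.smooth (h i)) := by
      simp only [dfn_chain (hp _), Finset.sum_mul]
      conv_rhs => rw [Finset.sum_comm]
      rw [← Finset.sum_neg_distrib]
      refine Finset.sum_congr rfl fun i _ => ?_
      rw [← Finset.sum_neg_distrib]
      refine Finset.sum_congr rfl fun j _ => ?_
      rw [hsymm i j, mul_assoc, mul_assoc, dfn_dfn_comm]
      simp
    have h2 : (2 : ℝ) • ∑ i, dfn (M.smooth (p i)) * dfn (M.smooth (h i)) = 0 := by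
      rw [two_smul]
      nth_rewrite 1 [hsum]
      exact neg_add_cancel _
    exact ((smul_eq_zero_iff_right (two_ne_zero (α := ℝ))).1 h2).symm

/-- The de Rham differential: the graded derivation of degree one with `d(h) = dh`, `d(dh) = 0`. -/
def d : Form M →ₗ[ℝ] Form M := derivation isDerData_d

/-- The value of a vector field on a homogeneous function. -/
def _root_.VF.app {k : ℤ} (X : VF M k) {i : ℤ} (h : M.Homog i) : M.Homog (i + k) :=
  ⟨X.1 ⊤ h.1, X.2.mem h.2⟩

theorem isDerData_contract {k : ℤ} (X : VF M k) :
    IsDerData (k - 1) (fun _ _ => 0) (fun _ h => fn (M := M) (VF.app X h)) where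
  fn_add _ _ := by simp
  fn_smul _ _ := by simp
  fn_one _ _ := rfl
  fn_mul _ _ _ _ _ := by simp
  d_add a b := by
    rw [← fn_add]
    congr 1
    exact Subtype.ext (map_add _ _ _)
  d_smul r a := by
    rw [← fn_smul]
    congr 1
    exact Subtype.ext (map_smul _ _ _)
  d_mul {i j l} a b c hk h := by
    subst hk
    have m1 : X.1 ⊤ a.1 * b.1 ∈ M.Homog (i + j + k) := by
      have := M.mul_mem (X.2.mem a.2) b.2
      rwa [show i + k + j = i + j + k by ring] at this
    have m2 : a.1 * X.1 ⊤ b.1 ∈ M.Homog (i + j + k) := by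
      have := M.mul_mem a.2 (X.2.mem b.2)
      rwa [← add_assoc] at this
    have e : VF.app X c = ⟨_, m1⟩ + (-1 : ℝ) ^ (k * i) • ⟨_, m2⟩ := by
      refine Subtype.ext ?_
      change X.1 ⊤ c.1 = _
      rw [h, X.2.leibniz _ a.2]
      rfl
    rw [e, fn_add, fn_smul, fn_mul (VF.app X a) b ⟨_, m1⟩ (by ring) rfl,
      fn_mul a (VF.app X b) ⟨_, m2⟩ (by ring) rfl]
    simp only [mul_zero, smul_zero, add_zero, zero_mul, zero_add, smul_smul, neg_one_zpow_mul]
    congr 3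
    ring
  fn_d_comm {i j} a b := by
    rw [fn_fn_comm a (VF.app X b)]
    simp only [mul_zero, smul_zero, add_zero, zero_mul, zero_add, smul_smul, neg_one_zpow_mul]
    congr 1
    exact neg_one_zpow_congr ⟨i * (k - 1), by ring⟩
  d_d_comm {i j} a b := by
    rw [fn_dfn_comm (VF.app X a) b, fn_dfn_comm (VF.app X b) a]
    simp only [smul_add, smul_smul, neg_one_zpow_mul]
    rw [add_comm]
    congr 2
    · exact neg_one_zpow_congr ⟨-(i + 1) * (j + 1), by ring⟩
    · exact neg_one_zpow_congr ⟨0, by ring⟩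
  chain {m F h g p} H := by
    have m1 : ∀ i, M.ofSmooth ⊤ (p i) * X.1 ⊤ (M.ofSmooth ⊤ (h i)) ∈ M.Homog (0 + k) := fun i => by
      have := M.mul_mem (M.ofSmooth_mem (p i)) (X.2.mem (M.ofSmooth_mem (h i)))
      rwa [zero_add] at this
    have e : VF.app X (M.smooth g) = ∑ i, ⟨_, m1 i⟩ := by
      refine Subtype.ext ?_
      rw [AddSubmonoidClass.coe_finsetSum]
      exact H.vf_apply X
    let fnₗ : M.Homog (0 + k) →+ Form M :=
      AddMonoidHom.mk' fn fn_add
    have e2 := map_sum fnₗ (fun i => (⟨_, m1 i⟩ : M.Homog (0 + k))) Finset.univ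
    rw [e]
    refine e2.trans (Finset.sum_congr rfl fun i _ => ?_)
    rw [zero_mul]
    exact (fn_mul (M.smooth (p i)) (VF.app X (M.smooth (h i))) _ (by ring) rfl).trans
      (zero_add _).symm

/-- Contraction with a vector field `X` of degree `k`: the graded derivation of degree `k - 1` with
`ι_X h = 0`, `ι_X dh = X h`. -/
def contract {k : ℤ} (X : VF M k) : Form M →ₗ[ℝ] Form M := derivation (isDerData_contract X)

/-- The Lie derivative along a vector field `X` of degree `k`: `L_X = ι_X d + (-1)^k d ι_X`. -/
def lieDeriv {k : ℤ} (X : VF M k) : Form M →ₗ[ℝ] Form M :=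
  contract X ∘ₗ d + (-1 : ℝ) ^ k • (d ∘ₗ contract X)

end Form

/-! ### Pull-back of forms -/

namespace GMor

variable {M N : GradedManifold.{u}}

/-- Pull-back of homogeneous functions. -/
def pullHom (φ : GMor M N) {i : ℤ} (h : N.Homog i) : M.Homog i :=
  ⟨φ.pullTop h.1, φ.pull_mem _ h.2⟩

/-- The pull-backs of `h` and `dh`. -/
def pullFormGen (φ : GMor M N) : FormGen N → Form M
  | .fn _ h => Form.fn (φ.pullHom h)
  | .d _ h => Form.dfn (φ.pullHom h)

/-- Pull-back of smooth functions on the body. -/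
def pullSmTop (φ : GMor M N) (c : N.Sm ⊤) : M.Sm ⊤ := φ.pullSm (fun _ _ => Opens.mem_top _) c

theorem pullHom_smooth (φ : GMor M N) (c : N.Sm ⊤) :
    φ.pullHom (N.smooth c) = M.smooth (φ.pullSmTop c) :=
  Subtype.ext (φ.pull_ofSmooth _ c _ fun _ => rfl)

theorem isSmoothComp_pull (φ : GMor M N) {m : ℕ} {F : (Fin m → ℝ) → ℝ} {h : Fin m → N.Sm ⊤}
    {g : N.Sm ⊤} {p : Fin m → N.Sm ⊤} (H : GradedManifold.IsSmoothComp F h g p) :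
    GradedManifold.IsSmoothComp F (fun i => φ.pullSmTop (h i)) (φ.pullSmTop g)
      fun i => φ.pullSmTop (p i) :=
  ⟨H.contDiff, fun _ => H.eq _, fun i _ => H.partial_eq i _⟩

theorem pullFormGen_rel (φ : GMor M N) ⦃x y : FreeAlgebra ℝ (FormGen N)⦄ (h : FormRel N x y) :
    FreeAlgebra.lift ℝ φ.pullFormGen x = FreeAlgebra.lift ℝ φ.pullFormGen y := by
  have e0 : ∀ {i : ℤ} (h : N.Homog i),
      FreeAlgebra.lift ℝ φ.pullFormGen (FormGen.f h) = Form.fn (φ.pullHom h) := by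
    intro i h
    simp [FormGen.f, pullFormGen]
  have e1 : ∀ {i : ℤ} (h : N.Homog i),
      FreeAlgebra.lift ℝ φ.pullFormGen (FormGen.df h) = Form.dfn (φ.pullHom h) := by
    intro i h
    simp [FormGen.df, pullFormGen]
  have pa : ∀ {i : ℤ} (a b : N.Homog i), φ.pullHom (a + b) = φ.pullHom a + φ.pullHom b :=
    fun a b => Subtype.ext (map_add φ.pullTop _ _)
  have ps : ∀ {i : ℤ} (r : ℝ) (a : N.Homog i), φ.pullHom (r • a) = r • φ.pullHom a :=
    fun r a => Subtype.ext (map_smul φ.pullTop r a.1)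
  have pm : ∀ {i j k : ℤ} (a : N.Homog i) (b : N.Homog j) (c : N.Homog k), c.1 = a.1 * b.1 →
      (φ.pullHom c).1 = (φ.pullHom a).1 * (φ.pullHom b).1 := by
    intro i j k a b c h
    change φ.pullTop c.1 = φ.pullTop a.1 * φ.pullTop b.1
    rw [h, map_mul]
  cases h with
  | fn_add a b => simp only [map_add, e0, pa, Form.fn_add]
  | fn_smul r a => simp only [map_smul, e0, ps, Form.fn_smul]
  | fn_one a h =>
    rw [e0, map_one]
    refine Form.fn_one _ ?_
    change φ.pullTop a.1 = 1
    rw [h, map_one]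
  | fn_mul a b c hk h => rw [map_mul, e0, e0, e0, Form.fn_mul _ _ _ hk (pm a b c h)]
  | d_add a b => simp only [map_add, e1, pa, Form.dfn_add]
  | d_smul r a => simp only [map_smul, e1, ps, Form.dfn_smul]
  | d_mul a b c hk h =>
    simp only [map_add, map_mul, map_smul, e0, e1]
    exact Form.dfn_mul _ _ _ hk (pm a b c h)
  | fn_d_comm a b =>
    simp only [map_mul, map_smul, e0, e1]
    exact Form.fn_dfn_comm _ _
  | d_d_comm a b =>
    simp only [map_mul, map_smul, e1]
    exact Form.dfn_dfn_comm _ _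
  | chain H =>
    simp only [map_sum, map_mul, e0, e1, pullHom_smooth]
    exact Form.dfn_chain (φ.isSmoothComp_pull H)

/-- Pull-back of differential forms: `φ^*(h) = φ^* h`, `φ^*(dh) = d(φ^* h)`. -/
def pullForm (φ : GMor M N) : Form N →ₐ[ℝ] Form M := Form.lift φ.pullFormGen φ.pullFormGen_rel

end GMor

/-! ### Q-manifolds and the field strength -/

/-- A Q-manifold: a graded manifold with a vector field of degree one squaring to zero. -/
structure QManifold extends GradedManifold.{u} where
  Q : VF toGradedManifold 1
  Q_sq : ∀ (U : Opens Body) (a : fn U), Q.1 U (Q.1 U a) = 0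

namespace QManifold

variable {M N : QManifold.{u}}

/-- The field strength operator `F = Q₁ φ^* - φ^* Q₂` of a morphism of graded manifolds. -/
def fieldStrength (φ : GMor M.toGradedManifold N.toGradedManifold) : N.Fn →ₗ[ℝ] M.Fn :=
  M.Q.1 ⊤ ∘ₗ φ.pullTop.toLinearMap - φ.pullTop.toLinearMap ∘ₗ N.Q.1 ⊤

theorem fieldStrength_apply (φ : GMor M.toGradedManifold N.toGradedManifold) (a : N.Fn) :
    fieldStrength φ a = M.Q.1 ⊤ (φ.pullTop a) - φ.pullTop (N.Q.1 ⊤ a) := rfl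

theorem fieldStrength_mem (φ : GMor M.toGradedManifold N.toGradedManifold) {i : ℤ} {a : N.Fn}
    (ha : a ∈ N.Homog i) : fieldStrength φ a ∈ M.Homog (i + 1) :=
  sub_mem (M.Q.2.mem (φ.pull_mem _ ha)) (φ.pull_mem _ (N.Q.2.mem ha))

theorem fieldStrength_mul (φ : GMor M.toGradedManifold N.toGradedManifold) {i : ℤ} {a : N.Fn}
    (ha : a ∈ N.Homog i) (b : N.Fn) : fieldStrength φ (a * b) =
      fieldStrength φ a * φ.pullTop b + (-1 : ℝ) ^ i • (φ.pullTop a * fieldStrength φ b) := by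
  have h1 : φ.pullTop a ∈ M.Homog i := φ.pull_mem _ ha
  simp only [fieldStrength_apply, map_mul, M.Q.2.leibniz _ h1, N.Q.2.leibniz _ ha, map_add,
    map_smul, one_mul, sub_mul, mul_sub, smul_sub]
  abel

/-- The values `φ^* h` and `F(h)` of `f^*` on the generators `h` and `dh`. -/
def fGen (φ : GMor M.toGradedManifold N.toGradedManifold) :
    FormGen N.toGradedManifold → M.Fn
  | .fn _ h => φ.pullTop h.1
  | .d _ h => fieldStrength φ h.1

theorem fGen_rel (φ : GMor M.toGradedManifold N.toGradedManifold)
    ⦃x y : FreeAlgebra ℝ (FormGen N.toGradedManifold)⦄ (h : FormRel N.toGradedManifold x y) :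
    FreeAlgebra.lift ℝ (fGen φ) x = FreeAlgebra.lift ℝ (fGen φ) y := by
  have e0 : ∀ {i : ℤ} (h : N.Homog i),
      FreeAlgebra.lift ℝ (fGen φ) (FormGen.f h) = φ.pullTop h.1 := by
    intro i h
    simp [FormGen.f, fGen]
  have e1 : ∀ {i : ℤ} (h : N.Homog i),
      FreeAlgebra.lift ℝ (fGen φ) (FormGen.df h) = fieldStrength φ h.1 := by
    intro i h
    simp [FormGen.df, fGen]
  cases h with
  | fn_add a b => simp [e0]
  | fn_smul r a => simp [e0]
  | fn_one a h => rw [e0, h, map_one, map_one]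
  | fn_mul a b c hk h => rw [map_mul, e0, e0, e0, h, map_mul]
  | d_add a b => simp [e1]
  | d_smul r a => simp [e1]
  | d_mul a b c hk h =>
    simp only [map_add, map_mul, map_smul, e0, e1]
    rw [h, fieldStrength_mul φ a.2]
  | fn_d_comm a b =>
    simp only [map_mul, map_smul, e0, e1]
    exact M.graded_comm (φ.pull_mem _ a.2) (fieldStrength_mem φ b.2)
  | d_d_comm a b =>
    simp only [map_mul, map_smul, e1]
    exact M.graded_comm (fieldStrength_mem φ a.2) (fieldStrength_mem φ b.2)
  | @chain m F h g p H =>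
    simp only [map_sum, map_mul, e0, e1]
    have e : ∀ c : N.Sm ⊤, φ.pullTop (N.smooth c).1 = M.ofSmooth ⊤ (φ.pullSmTop c) := fun c =>
      congrArg Subtype.val (φ.pullHom_smooth c)
    have h1 := H.vf_apply N.Q
    have h2 := (φ.isSmoothComp_pull H).vf_apply M.Q
    simp only [fieldStrength_apply, mul_sub, Finset.sum_sub_distrib, e]
    rw [h2]
    congr 1
    change φ.pullTop (N.Q.1 ⊤ (N.ofSmooth ⊤ g)) = _
    rw [h1, map_sum]
    refine Finset.sum_congr rfl fun i _ => ?_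
    rw [map_mul]
    congr 1
    exact e (p i)

/-- The morphism of algebras `f^* : Ω(N) → C^∞(M)` attached to a morphism of graded manifolds
`φ : M → N`: it is determined by `f^*(h) = φ^*(h)` and `f^*(dh) = F(h)`. -/
def fStar (φ : GMor M.toGradedManifold N.toGradedManifold) :
    Form N.toGradedManifold →ₐ[ℝ] M.Fn :=
  Form.lift (fGen φ) (fGen_rel φ)

end QManifold

/-! ### Trivial Q-bundles -/

/-- `φ` is a morphism of Q-manifolds: `Q₁ φ^* = φ^* Q₂`. -/
def IsQMorphism {M N : QManifold.{u}} (φ : GMor M.toGradedManifold N.toGradedManifold) : Prop :=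
  ∀ (U : Opens N.Body) (V : Opens M.Body) (h : ∀ x ∈ V, φ.base x ∈ U) (a : N.fn U),
    M.Q.1 V (φ.pull U V h a) = φ.pull U V h (N.Q.1 U a)

/-- `π : M → M₁` and `ρ : M → M₂` exhibit the graded manifold `M` as the product `M₁ × M₂`: the body
of `M` is the product of the bodies, and coordinates on `U₁ ⊆ M₁` together with coordinates on
`U₂ ⊆ M₂` are coordinates on `U₁ × U₂`. -/
structure IsProduct {M₁ M₂ M : GradedManifold.{u}} (π : GMor M M₁) (ρ : GMor M M₂) : Prop where
  body : ∃ e : M.Body ≃ₘ⟮𝓡 M.dim, (𝓡 M₁.dim).prod (𝓡 M₂.dim)⟯ (M₁.Body × M₂.Body),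
    ∀ x, e x = (π.base x, ρ.base x)
  coord : ∀ (U₁ : Opens M₁.Body) (ξ : Fin M₁.rank → M₁.fn U₁) (U₂ : Opens M₂.Body)
    (η : Fin M₂.rank → M₂.fn U₂),
    GradedSpace.IsCoord U₁ M₁.deg ξ → GradedSpace.IsCoord U₂ M₂.deg η →
    GradedSpace.IsCoord (M := M.toGradedSpace) (π.pre U₁ ⊓ ρ.pre U₂) (Fin.append M₁.deg M₂.deg)
      (Fin.append (fun i => π.pull U₁ (π.pre U₁ ⊓ ρ.pre U₂) (fun _ hx => hx.1) (ξ i))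
        (fun i => ρ.pull U₂ (π.pre U₁ ⊓ ρ.pre U₂) (fun _ hx => hx.2) (η i)))

/-- `π : M → M₁`, with second projection `ρ : M → M₂`, is the trivial Q-bundle `M₁ × M₂ → M₁`: the
graded manifold `M` is the product of `M₁` and `M₂`, and its homological vector field is `Q₁ + Q₂`,
that is, both projections are morphisms of Q-manifolds. -/
structure IsTrivialQBundle {M₁ M₂ M : QManifold.{u}}
    (π : GMor M.toGradedManifold M₁.toGradedManifold)
    (ρ : GMor M.toGradedManifold M₂.toGradedManifold) : Prop where
  isProduct : IsProduct π ρ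
  isQMorphism_fst : IsQMorphism π
  isQMorphism_snd : IsQMorphism ρ

/-- A section (gauge field), in the category of graded manifolds, of `π : M → M₁`. -/
def IsSection {M₁ M : GradedManifold.{u}} (π : GMor M M₁) (φ : GMor M₁ M) : Prop :=
  π.comp φ = GMor.id M₁

/-- A graded Lie subalgebra of vector fields on a Q-manifold which is closed under the derived
bracket `[X, Y]_Q = [[X, Q], Y]`. -/
structure HolonomyAlgebra (M : QManifold.{u}) where
  part : ∀ k : ℤ, Submodule ℝ (VF M.toGradedManifold k)
  bracket_mem : ∀ {k l : ℤ} {X : VF M.toGradedManifold k} {Y : VF M.toGradedManifold l},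
    X ∈ part k → Y ∈ part l → VF.bracket X Y ∈ part (k + l)
  derived_mem : ∀ {k l : ℤ} {X : VF M.toGradedManifold k} {Y : VF M.toGradedManifold l},
    X ∈ part k → Y ∈ part l → VF.bracket (VF.bracket X M.Q) Y ∈ part (k + 1 + l)

/-- `G`-basic forms: `L_ε α = 0 = L_{[Q, ε]} α` for all `ε` in `G`. -/
def HolonomyAlgebra.IsBasic {M : QManifold.{u}} (G : HolonomyAlgebra M)
    (α : Form M.toGradedManifold) : Prop :=
  ∀ (k : ℤ) (ε : VF M.toGradedManifold k), ε ∈ G.part k →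
    Form.lieDeriv ε α = 0 ∧ Form.lieDeriv (VF.bracket M.Q ε) α = 0

/-- `Z` is the vector field on `M = M₁ × M₂` acting as `Y` along the factor `M₂` and trivially along
`M₁`. -/
structure IsVerticalLift {M₁ M₂ M : GradedManifold.{u}} (π : GMor M M₁) (ρ : GMor M M₂) {k : ℤ}
    (Y : VF M₂ k) (Z : VF M k) : Prop where
  fst : ∀ (U : Opens M₁.Body) (V : Opens M.Body) (h : ∀ x ∈ V, π.base x ∈ U) (a : M₁.fn U),
    Z.1 V (π.pull U V h a) = 0
  snd : ∀ (U : Opens M₂.Body) (V : Opens M.Body) (h : ∀ x ∈ V, ρ.base x ∈ U) (a : M₂.fn U),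
    Z.1 V (ρ.pull U V h a) = ρ.pull U V h (Y.1 U a)

section TrivialBundle

variable {M₁ M₂ M : QManifold.{u}} (π : GMor M.toGradedManifold M₁.toGradedManifold)
  (ρ : GMor M.toGradedManifold M₂.toGradedManifold) (G : HolonomyAlgebra M₂)

/-- The elements of degree `k` of `C^∞(M₁, G)`, as vertical vector fields on `M = M₁ × M₂`: linear
combinations of products `b Y` with `b` a homogeneous function on `M₁` and `Y` in `G`. -/
def gaugeParameters (k : ℤ) : Submodule ℝ (VF M.toGradedManifold k) :=
  Submodule.span ℝ {Z | ∃ (i j : ℤ) (b : M₁.Homog i) (Y : VF M₂.toGradedManifold j)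
    (Y' : VF M.toGradedManifold j), i + j = k ∧ Y ∈ G.part j ∧ IsVerticalLift π ρ Y Y' ∧
    ∀ (U : Opens M.Body) (a : M.fn U), Z.1 U a = M.res le_top (π.pullTop b.1) * Y'.1 U a}

/-- The Lie algebra `G' = ad_Q (C^∞(M₁, G)) ∩ D⁰(M₁ × M₂)`. As `ad_Q` has degree one, only the
elements of degree `-1` of `C^∞(M₁, G)` contribute. -/
def gaugeAlgebra : Set (VF M.toGradedManifold 0) :=
  {X | ∃ Y ∈ gaugeParameters π ρ G (-1), X.1 = (VF.bracket M.Q Y).1}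

end TrivialBundle

/-! ### Integral families and exponentials -/

/-- `Φ t`, `t ∈ J`, is a smooth family of morphisms `N → M` which solves `d/dt Φ_t^* = Φ_t^* ∘ X`:
in local coordinates on `N`, the coefficients of `Φ_t^* h` depend smoothly on `t` and on the point
of the body, and their derivatives in `t` are the coefficients of `Φ_t^* (X h)`. -/
structure IsIntegralFamily {N M : GradedManifold.{u}} (J : Set ℝ) (Φ : ℝ → GMor N M)
    (X : VF M 0) : Prop where
  smooth : ∀ (h : M.Fn) (U : Opens N.Body) (ξ : Fin N.rank → N.fn U)
    (hξ : GradedSpace.IsCoord U N.deg ξ) (I : MultiIndex N.deg),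
    ContMDiffOn (𝓘(ℝ, ℝ).prod (𝓡 N.dim)) 𝓘(ℝ, ℝ) ∞
      (fun p : ℝ × U => hξ.coeff (N.res le_top ((Φ p.1).pullTop h)) I p.2) (J ×ˢ Set.univ)
  hasDerivAt : ∀ (h : M.Fn) (U : Opens N.Body) (ξ : Fin N.rank → N.fn U)
    (hξ : GradedSpace.IsCoord U N.deg ξ) (I : MultiIndex N.deg), ∀ t ∈ J, ∀ x : U,
    HasDerivAt (fun s => hξ.coeff (N.res le_top ((Φ s).pullTop h)) I x)
      (hξ.coeff (N.res le_top ((Φ t).pullTop (X.1 ⊤ h))) I x) t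

/-- `Ψ` is the (global) flow of the degree zero vector field `X`. -/
structure IsFlow {M : GradedManifold.{u}} (X : VF M 0) (Ψ : ℝ → GMor M M) : Prop where
  zero : Ψ 0 = GMor.id M
  add : ∀ s t, Ψ (s + t) = (Ψ s).comp (Ψ t)
  isIntegralFamily : IsIntegralFamily Set.univ Ψ X

/-- The group generated by the exponentials (time-one flows) of the complete vector fields in `S`.
(For `S` stable under `X ↦ -X` this is closed under inverses.) -/
inductive ExpGroup {M : GradedManifold.{u}} (S : Set (VF M 0)) : GMor M M → Prop
  | exp {X : VF M 0} {Ψ : ℝ → GMor M M} (hX : X ∈ S) (h : IsFlow X Ψ) : ExpGroup S (Ψ 1)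
  | comp {Ψ Ψ' : GMor M M} (h : ExpGroup S Ψ) (h' : ExpGroup S Ψ') : ExpGroup S (Ψ.comp Ψ')

end

/-! Put `a = ρ ∘ φ`. Since `ρ` is a Q-morphism, `f_φ^*(ρ^*α) = f_a^*(α)` (`fStar_pullForm`), so only
the component of the section in `M₂` matters. Take a gauge parameter `Z = bY` with `deg b + deg Y =
-1`, and `X = [Q, Z]`. Along `d/dt φ_t^* = φ_t^* X` one has `d/dt f_a^* = (Q₁b) · f_a^* L_Y +
(-1)^(deg b) b · f_a^* L_{[Q₂,Y]}`. Both sides are derivations along the algebra morphism `f_a^*`: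
in each term on the right the coefficient and the Lie derivative have opposite degrees, so the signs
produced by passing a generator cancel. Hence it suffices to compare the two sides on the generators
`h` and `dh`. On `h` this is the expansion of `[Q, bY]` (`pullTop_bracket_apply`); on `dh` it also
uses `Q₁² = Q₂² = 0` (`fieldStrength_variation`). For basic `α` both Lie derivatives vanish, so
`f_a^*(α)` has zero derivative. `exists_variation` packages the right-hand side, extended linearly
to all gauge parameters.

The analytic part gives `d/dt` a meaning for families of functions on a graded manifold: they are
differentiated coefficient by coefficient in graded coordinates (`HasFnDerivAt`). As the coordinates
have positive degrees, a given coefficient of a product with a homogeneous factor, of `X g`, or of a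
pull-back is a sum over a finite set of exponents that does not depend on `t`. The product rule
follows. The field strength contains `Q₁ φ_t^*`, so `d/dt` must also commute with `Q₁`: a vector
field acts on coefficients by first order operators (`exists_firstOrder`, through Hadamard's lemma),
and mixed partials commute because the coefficients are jointly smooth in `t` and the point. A zero
derivative on an interval gives constancy.

For the group action, `X` annihilates `π^* C^∞(M₁)`, so its flow `Ψ_t` fixes these functions; a
morphism is determined by the pull-back of global functions (`ext_pullTop`), whence `π ∘ Ψ_t = π`.
Then `Ψ_t ∘ φ` is an integral family of sections, and comparing `t = 0` with `t = 1` settles one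
exponential; products follow by induction. -/

/-! ### Degrees of monomials and coefficients in graded coordinates. -/

/-- The total degree of the monomial with exponents `I`. -/
def MultiIndex.degree {r : ℕ} {d : Fin r → ℤ} (I : MultiIndex d) : ℤ := ∑ i, (I.1 i : ℤ) * d i

theorem MultiIndex.degree_nonneg {r : ℕ} {d : Fin r → ℤ} (hd : ∀ i, 0 < d i) (I : MultiIndex d) :
    0 ≤ I.degree :=
  Finset.sum_nonneg fun i _ => mul_nonneg (Int.natCast_nonneg _) (hd i).le

/-- Every variable has degree at least one, so each exponent is bounded by `n`. This is the source
of all finiteness below: it bounds the exponents that can contribute to a coefficient, uniformly in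
any parameter. -/
theorem MultiIndex.finite_degree_le {r : ℕ} {d : Fin r → ℤ} (hd : ∀ i, 0 < d i) (n : ℤ) :
    {I : MultiIndex d | I.degree ≤ n}.Finite := by
  refine Set.Finite.of_finite_image (f := Subtype.val) ?_ Subtype.val_injective.injOn
  refine (Set.Finite.pi' fun _ : Fin r => Set.finite_Iic n.toNat).subset ?_
  rintro _ ⟨I, hI, rfl⟩ i
  have h1 : (I.1 i : ℤ) * d i ≤ I.degree :=
    Finset.single_le_sum (f := fun i => (I.1 i : ℤ) * d i)
      (fun i _ => mul_nonneg (Int.natCast_nonneg _) (hd i).le) (Finset.mem_univ i)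
  have h2 : (I.1 i : ℤ) * 1 ≤ (I.1 i : ℤ) * d i :=
    mul_le_mul_of_nonneg_left (hd i) (Int.natCast_nonneg _)
  have h3 : I.degree ≤ n := hI
  change I.1 i ≤ n.toNat
  omega

namespace GradedSpace

variable {M : GradedSpace.{u}}

theorem pow_mem_grading {U : Opens M.Body} {k : ℤ} {a : M.fn U} (ha : a ∈ M.grading U k) (n : ℕ) :
    a ^ n ∈ M.grading U (n * k) := by
  induction n with
  | zero => simpa using M.one_mem U
  | succ n ih =>
    have := M.mul_mem ih ha
    rwa [← pow_succ, show (n : ℤ) * k + k = ((n + 1 : ℕ) : ℤ) * k by push_cast; ring] at this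

theorem prod_ofFn_mem_grading {U : Opens M.Body} {r : ℕ} {e : Fin r → ℤ} {a : Fin r → M.fn U}
    (ha : ∀ i, a i ∈ M.grading U (e i)) : (List.ofFn a).prod ∈ M.grading U (∑ i, e i) := by
  induction r with
  | zero => simpa using M.one_mem U
  | succ r ih =>
    rw [List.ofFn_succ, List.prod_cons, Fin.sum_univ_succ]
    exact M.mul_mem (ha 0) (ih fun i => ha i.succ)

theorem monomial_mem_grading {U : Opens M.Body} {r : ℕ} {d : Fin r → ℤ} {ξ : Fin r → M.fn U}
    (hξ : ∀ i, ξ i ∈ M.grading U (d i)) (I : MultiIndex d) :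
    monomial ξ I ∈ M.grading U I.degree :=
  prod_ofFn_mem_grading fun i => pow_mem_grading (hξ i) _

/-- Functions of degree zero coming from the body are central. -/
theorem ofSmooth_mul_comm {U : Opens M.Body} (s : M.Sm U) (a : M.fn U) :
    M.ofSmooth U s * a = a * M.ofSmooth U s := by
  refine Submodule.iSup_induction (motive := fun a => M.ofSmooth U s * a = a * M.ofSmooth U s)
    (M.grading U) (x := a) ?_ (fun i x hx => ?_) ?_ fun x y hx hy => ?_
  · rw [(M.isInternal U).submodule_iSup_eq_top]
    trivial
  · simpa using M.graded_comm (M.ofSmooth_mem s) hx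
  · simp
  · rw [mul_add, add_mul, hx, hy]

namespace IsCoord

variable {U : Opens M.Body} {r : ℕ} {d : Fin r → ℤ} {ξ : Fin r → M.fn U} (hξ : IsCoord U d ξ)

/-- Immediate because the expansion property is demanded over every smaller open set, not only over
`U`. -/
theorem restrict (hξ : IsCoord U d ξ) {V : Opens M.Body} (h : V ≤ U) :
    IsCoord V d fun i => M.res h (ξ i) where
  deg_pos := hξ.deg_pos
  mem i := M.res_mem h (hξ.mem i)
  existsUnique W hW a := by
    simp only [M.res_res]
    exact hξ.existsUnique W _ a

theorem eq_sum_coeff (a : M.fn U) :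
    a = (hξ.coeff a).sum fun I s => M.ofSmooth U s * monomial ξ I := by
  refine (hξ.existsUnique U le_rfl a).choose_spec.1.trans ?_
  change (hξ.coeff a).sum _ = _
  simp only [M.res_self]

theorem coeff_unique {a : M.fn U} {c : MultiIndex d →₀ M.Sm U}
    (h : a = c.sum fun I s => M.ofSmooth U s * monomial ξ I) : hξ.coeff a = c := by
  refine ((hξ.existsUnique U le_rfl a).choose_spec.2 c ?_).symm
  simpa only [M.res_self] using h

theorem coeff_add (a b : M.fn U) : hξ.coeff (a + b) = hξ.coeff a + hξ.coeff b := by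
  refine hξ.coeff_unique ?_
  rw [Finsupp.sum_add_index' (by simp) (by simp [add_mul]), ← hξ.eq_sum_coeff, ← hξ.eq_sum_coeff]

theorem coeff_ofSmooth_mul (s : M.Sm U) (a : M.fn U) :
    hξ.coeff (M.ofSmooth U s * a) = s • hξ.coeff a := by
  refine hξ.coeff_unique ?_
  rw [Finsupp.sum_smul_index' (by simp)]
  conv_lhs => rw [hξ.eq_sum_coeff a, Finsupp.mul_sum]
  simp [mul_assoc]

theorem ofSmooth_algebraMap_mul (x : ℝ) (a : M.fn U) :
    M.ofSmooth U (algebraMap ℝ _ x) * a = x • a := by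
  rw [AlgHom.commutes, Algebra.smul_def]

theorem coeff_smul (x : ℝ) (a : M.fn U) : hξ.coeff (x • a) = x • hξ.coeff a := by
  rw [← ofSmooth_algebraMap_mul, coeff_ofSmooth_mul]
  ext I
  simp [Algebra.smul_def]

/-- The value at a point of a coefficient, as a linear functional. -/
noncomputable def coeffAt (I : MultiIndex d) (x : U) : M.fn U →ₗ[ℝ] ℝ where
  toFun a := hξ.coeff a I x
  map_add' a b := by rw [coeff_add]; rfl
  map_smul' c a := by rw [coeff_smul]; rfl

theorem coeffAt_apply (I : MultiIndex d) (x : U) (a : M.fn U) :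
    hξ.coeffAt I x a = hξ.coeff a I x := rfl

theorem coeffAt_ofSmooth_mul (I : MultiIndex d) (x : U) (s : M.Sm U) (a : M.fn U) :
    hξ.coeffAt I x (M.ofSmooth U s * a) = s x * hξ.coeffAt I x a := by
  rw [coeffAt_apply, coeff_ofSmooth_mul]; rfl

theorem ext_coeffAt {a b : M.fn U} (h : ∀ I x, hξ.coeffAt I x a = hξ.coeffAt I x b) : a = b := by
  rw [hξ.eq_sum_coeff a, hξ.eq_sum_coeff b]
  congr 1
  ext I x
  exact h I x

/-- Coefficients are compatible with restriction. -/
theorem coeffAt_res {V : Opens M.Body} (h : V ≤ U) (a : M.fn U) (I : MultiIndex d) (x : V) :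
    (hξ.restrict h).coeffAt I x (M.res h a) = hξ.coeffAt I ⟨x.1, h x.2⟩ a := by
  let R := ContMDiffMap.restrictRingHom (n := ∞) (𝓡 M.dim) 𝓘(ℝ, ℝ) ℝ h
  have hm : ∀ I : MultiIndex d, M.res h (monomial ξ I) = monomial (fun i => M.res h (ξ i)) I := by
    intro I
    simp [monomial, map_list_prod, List.map_ofFn, Function.comp_def]
  have : (hξ.restrict h).coeff (M.res h a) = (hξ.coeff a).mapRange R (map_zero R) := by
    refine coeff_unique _ ?_
    rw [Finsupp.sum_mapRange_index (by simp)]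
    conv_lhs => rw [hξ.eq_sum_coeff a, map_finsuppSum]
    simp only [map_mul, M.res_ofSmooth, hm]
    rfl
  rw [coeffAt_apply, this]
  rfl

theorem ofSmooth_mul_monomial_mem (hξ : IsCoord U d ξ) (s : M.Sm U) (I : MultiIndex d) :
    M.ofSmooth U s * monomial ξ I ∈ M.grading U I.degree := by
  have := M.mul_mem (M.ofSmooth_mem s) (monomial_mem_grading hξ.mem I)
  rwa [zero_add] at this

/-- The monomials of degree other than `k` in the expansion of `a` add up to an element lying both
in degree `k` and in the sum of the other degrees, hence to zero. By uniqueness of the expansion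
their coefficients are then zero. -/
theorem coeffAt_eq_zero_of_mem {k : ℤ} {a : M.fn U} (ha : a ∈ M.grading U k) {I : MultiIndex d}
    (hI : I.degree ≠ k) (x : U) : hξ.coeffAt I x a = 0 := by
  classical
  let g := fun (I : MultiIndex d) (s : M.Sm U) => M.ofSmooth U s * monomial ξ I
  let c := hξ.coeff a
  have hsplit : (c.filter fun I => I.degree = k).sum g + (c.filter fun I => ¬ I.degree = k).sum g
      = a := by
    rw [← Finsupp.sum_add_index' (by simp [g]) (by simp [g, add_mul]), Finsupp.filter_add_filter_not]
    exact (hξ.eq_sum_coeff a).symm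
  have h1 : (c.filter fun I => I.degree = k).sum g ∈ M.grading U k := by
    refine Submodule.sum_mem _ fun I hI => ?_
    rw [Finsupp.support_filter, Finset.mem_filter] at hI
    exact hI.2 ▸ hξ.ofSmooth_mul_monomial_mem _ I
  have h2 : (c.filter fun I => ¬ I.degree = k).sum g ∈ ⨆ j ≠ k, M.grading U j := by
    refine Submodule.sum_mem _ fun I hI => ?_
    rw [Finsupp.support_filter, Finset.mem_filter] at hI
    exact Submodule.mem_iSup_of_mem I.degree (Submodule.mem_iSup_of_mem hI.2
      (hξ.ofSmooth_mul_monomial_mem _ I))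
  have h3 : (c.filter fun I => ¬ I.degree = k).sum g ∈ M.grading U k := by
    rw [← eq_sub_iff_add_eq'] at hsplit
    rw [hsplit]
    exact sub_mem ha h1
  have h4 := (Submodule.disjoint_def.1 ((M.isInternal U).submodule_iSupIndep k)) _ h3 h2
  rw [h4, add_zero] at hsplit
  rw [coeffAt_apply, hξ.coeff_unique hsplit.symm, Finsupp.filter_apply_neg (fun I : MultiIndex d => I.degree = k) _ hI]
  rfl

/-- The finite set of exponents of degree at most `n`. -/
noncomputable def indices (n : ℤ) : Finset (MultiIndex d) :=
  (MultiIndex.finite_degree_le hξ.deg_pos n).toFinset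

/-- A linear functional that vanishes in degrees above `n` only depends on the finitely many
coefficients of degree at most `n`. -/
theorem apply_eq_sum_indices (l : M.fn U →ₗ[ℝ] ℝ) (n : ℤ)
    (hl : ∀ k, n < k → ∀ a ∈ M.grading U k, l a = 0) (a : M.fn U) :
    l a = ∑ J ∈ hξ.indices n, l (M.ofSmooth U (hξ.coeff a J) * monomial ξ J) := by
  classical
  conv_lhs => rw [hξ.eq_sum_coeff a, map_finsuppSum]
  -- The support of the expansion depends on `a`, while the target index set does not. Enlarging to
  -- the union costs only zero coefficients; the terms outside `indices n` have degree above `n` and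
  -- are killed by `l`.
  rw [Finsupp.sum_of_support_subset _ (Finset.subset_union_left (s₂ := hξ.indices n)) _ (by simp)]
  refine (Finset.sum_subset Finset.subset_union_right fun J _ hJ => ?_).symm
  refine hl J.degree ?_ _ (hξ.ofSmooth_mul_monomial_mem _ J)
  simpa [indices] using hJ

end IsCoord

end GradedSpace

/-! ### Calculus with a real parameter, and point derivations. -/

/-- Mixed partial derivatives in a real parameter and in a space variable commute. -/
theorem hasDerivAt_fderiv_param {E : Type*} [NormedAddCommGroup E] [NormedSpace ℝ E]
    {G G' : ℝ × E → ℝ} {t : ℝ} {p : E} (hG : ContDiffAt ℝ ∞ G (t, p))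
    (hG' : ∀ᶠ q in nhds (t, p), HasDerivAt (fun τ => G (τ, q.2)) (G' q) q.1) (v : E) :
    HasDerivAt (fun τ => fderiv ℝ (fun b => G (τ, b)) p v) (fderiv ℝ (fun b => G' (t, b)) p v)
      t := by
  have hd : ∀ᶠ q in nhds (t, p), DifferentiableAt ℝ G q := by
    have h1 : ContDiffAt ℝ 1 G (t, p) := hG.of_le (by exact_mod_cast le_top)
    exact (h1.eventually (by simp)).mono fun q hq => hq.differentiableAt (by simp)
  have hdd : DifferentiableAt ℝ (fderiv ℝ G) (t, p) :=
    (hG.fderiv_right (m := ∞) (by simp)).differentiableAt (by simp)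
  have hsymm : IsSymmSndFDerivAt ℝ G (t, p) := hG.isSymmSndFDerivAt
    (by rw [minSmoothness_of_isRCLikeNormedField]; exact WithTop.coe_le_coe.2 le_top)
  have ct : ContinuousAt (fun τ : ℝ => (τ, p)) t := by fun_prop
  have cp : ContinuousAt (fun b : E => (t, b)) p := by fun_prop
  have e1 : (fun τ => fderiv ℝ (fun b => G (τ, b)) p v) =ᶠ[nhds t]
      fun τ => fderiv ℝ G (τ, p) (0, v) := by
    filter_upwards [ct.eventually hd] with τ hτ
    have : HasFDerivAt (fun b => G (τ, b)) _ p :=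
      hτ.hasFDerivAt.comp p (hasFDerivAt_prodMk_right τ p)
    rw [this.fderiv]
    simp
  -- No regularity of `G'` is assumed: near `p` it coincides with the time partial of `G`, and it
  -- inherits differentiability from there.
  have e2 : (fun b => G' (t, b)) =ᶠ[nhds p] fun b => fderiv ℝ G (t, b) (1, 0) := by
    filter_upwards [cp.eventually hd, cp.eventually hG'] with b hb hb'
    refine hb'.unique ?_
    have := hb.hasFDerivAt.comp_hasDerivAt t ((hasDerivAt_id t).prodMk (hasDerivAt_const t b))
    exact this
  have h1 : HasDerivAt (fun τ => fderiv ℝ G (τ, p) (0, v))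
      (fderiv ℝ (fderiv ℝ G) (t, p) (1, 0) (0, v)) t := by
    have := hdd.hasFDerivAt.comp_hasDerivAt t ((hasDerivAt_id t).prodMk (hasDerivAt_const t p))
    exact this.clm_apply (hasDerivAt_const t ((0, v) : ℝ × E)) |>.congr_deriv (by simp)
  have h2 : HasFDerivAt (fun b => fderiv ℝ G (t, b) (1, 0))
      (((fderiv ℝ (fderiv ℝ G) (t, p)).comp (ContinuousLinearMap.inr ℝ ℝ E)).flip (1, 0)) p := by
    have := (hdd.hasFDerivAt.comp p (hasFDerivAt_prodMk_right t p)).clm_apply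
      (hasFDerivAt_const ((1, 0) : ℝ × E) p)
    simpa using this
  rw [e2.fderiv_eq, h2.fderiv]
  refine (h1.congr_of_eventuallyEq e1).congr_deriv ?_
  simpa using hsymm (1, 0) (0, v)

section Manifold

variable {n : ℕ} {W : Type u} [TopologicalSpace W] [ChartedSpace (EuclideanSpace ℝ (Fin n)) W]
  [IsManifold (𝓡 n) ∞ W]

/-- The derivative at `x`, in the preferred chart at `x` and in the direction `v`, of a smooth
function depending smoothly on a parameter can be differentiated in the parameter. -/
theorem hasDerivAt_fderiv_chart {J : Set ℝ} (hJ : IsOpen J) {s s' : ℝ × W → ℝ}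
    (hs : ContMDiffOn (𝓘(ℝ, ℝ).prod (𝓡 n)) 𝓘(ℝ, ℝ) ∞ s (J ×ˢ Set.univ))
    (hs' : ∀ t ∈ J, ∀ y, HasDerivAt (fun τ => s (τ, y)) (s' (t, y)) t) {t : ℝ} (ht : t ∈ J)
    (x : W) (v : EuclideanSpace ℝ (Fin n)) :
    HasDerivAt (fun τ => fderiv ℝ (fun b => s (τ, (extChartAt (𝓡 n) x).symm b))
        (extChartAt (𝓡 n) x x) v)
      (fderiv ℝ (fun b => s' (t, (extChartAt (𝓡 n) x).symm b)) (extChartAt (𝓡 n) x x) v) t := by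
  refine hasDerivAt_fderiv_param (G := fun q => s (q.1, (extChartAt (𝓡 n) x).symm q.2))
    (G' := fun q => s' (q.1, (extChartAt (𝓡 n) x).symm q.2)) ?_ ?_ v
  · have h1 : ContMDiffAt 𝓘(ℝ, EuclideanSpace ℝ (Fin n)) (𝓡 n) ∞ (extChartAt (𝓡 n) x).symm
        (extChartAt (𝓡 n) x x) :=
      (contMDiffOn_extChartAt_symm x).contMDiffAt
        ((isOpen_extChartAt_target x).mem_nhds (mem_extChartAt_target x))
    have h2 : ContMDiffAt 𝓘(ℝ, ℝ × EuclideanSpace ℝ (Fin n)) (𝓘(ℝ, ℝ).prod (𝓡 n)) ∞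
        (fun q : ℝ × EuclideanSpace ℝ (Fin n) => (q.1, (extChartAt (𝓡 n) x).symm q.2))
        (t, extChartAt (𝓡 n) x x) := by
      refine ContMDiffAt.prodMk contDiff_fst.contMDiff.contMDiffAt ?_
      exact ContMDiffAt.comp (t, extChartAt (𝓡 n) x x) h1 contDiff_snd.contMDiff.contMDiffAt
    rw [← contMDiffAt_iff_contDiffAt]
    refine ContMDiffAt.comp (t, extChartAt (𝓡 n) x x) (g := s) (hs.contMDiffAt ?_) h2
    exact (hJ.prod isOpen_univ).mem_nhds ⟨ht, trivial⟩
  · have : ContinuousAt (fun q : ℝ × EuclideanSpace ℝ (Fin n) => q.1)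
      (t, extChartAt (𝓡 n) x x) := by fun_prop
    filter_upwards [this.eventually (hJ.mem_nhds ht)] with q hq using hs' _ hq _

/-- Off the target of the chart the inverse chart has meaningless values, but the bump function
vanishes near every such point, since its closed support ball lies inside the target. -/
theorem contDiff_bump_mul_chart {x : W} (χ : SmoothBumpFunction (𝓡 n) x)
    {s : W → ℝ} (hs : ContMDiff (𝓡 n) 𝓘(ℝ, ℝ) ∞ s) :
    ContDiff ℝ ∞ fun b => χ.toContDiffBump b * s ((extChartAt (𝓡 n) x).symm b) := by
  refine contDiff_iff_contDiffAt.2 fun b => ?_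
  by_cases hb : b ∈ (extChartAt (𝓡 n) x).target
  · refine χ.contDiffAt.mul ?_
    rw [← contMDiffAt_iff_contDiffAt]
    exact hs.contMDiffAt.comp b ((contMDiffOn_extChartAt_symm x).contMDiffAt
        ((isOpen_extChartAt_target x).mem_nhds hb))
  · have hb' : b ∉ Metric.closedBall (extChartAt (𝓡 n) x x) χ.rOut := fun h =>
      hb (χ.closedBall_subset ⟨h, by simp⟩)
    refine (contDiffAt_const (c := (0 : ℝ))).congr_of_eventuallyEq ?_
    filter_upwards [Metric.isClosed_closedBall.isOpen_compl.mem_nhds hb'] with y hy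
    have : χ.toContDiffBump y = 0 := χ.zero_of_le_dist (by
      rw [Set.mem_compl_iff, Metric.mem_closedBall, not_le] at hy
      exact hy.le)
    rw [this, zero_mul]

/-- A derivation at a point of the algebra of smooth functions is a directional derivative. -/
theorem exists_direction_of_pointDerivation [T2Space W] (x : W) (D : C^∞⟮𝓡 n, W; ℝ⟯ →ₗ[ℝ] ℝ)
    (hD : ∀ f g : C^∞⟮𝓡 n, W; ℝ⟯, D (f * g) = f x * D g + D f * g x) :
    ∃ v : EuclideanSpace ℝ (Fin n), ∀ s : C^∞⟮𝓡 n, W; ℝ⟯,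
      D s = fderiv ℝ (fun b => s ((extChartAt (𝓡 n) x).symm b)) (extChartAt (𝓡 n) x x) v := by
  let e := EuclideanSpace.equiv (Fin n) ℝ
  let φ := extChartAt (𝓡 n) x
  let χ : SmoothBumpFunction (𝓡 n) x := Classical.arbitrary _
  let c : C^∞⟮𝓡 n, W; ℝ⟯ := ⟨χ, χ.contMDiff⟩
  have hcx : c x = 1 := χ.eq_one
  -- With `c'` supported where `c = 1`, one has `c c' = c'`, and the Leibniz rule at `x` leaves `D c
  -- = 0`. So cutting off by `c` does not affect `D`.
  have hDc : D c = 0 := by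
    obtain ⟨χ', -, hχ'⟩ := (SmoothBumpFunction.nhds_basis_support (I := 𝓡 n) (c := x)
      Filter.univ_mem).mem_iff.1 χ.eventuallyEq_one
    let c' : C^∞⟮𝓡 n, W; ℝ⟯ := ⟨χ', χ'.contMDiff⟩
    have hcc : c * c' = c' := by
      refine ContMDiffMap.ext fun y => ?_
      change χ y * χ' y = χ' y
      by_cases hy : χ' y = 0
      · rw [hy, mul_zero]
      · have : χ y = 1 := hχ' hy
        rw [this, one_mul]
    have h := hD c c'
    have hc' : c' x = 1 := χ'.eq_one
    rw [hcc, hcx, hc'] at h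
    linarith
  have hcoord : ∀ i, ContMDiffOn (𝓡 n) 𝓘(ℝ, ℝ) ∞ (fun y => e (φ y) i - e (φ x) i)
      (chartAt (EuclideanSpace ℝ (Fin n)) x).source := by
    intro i
    have h1 : ContDiff ℝ ∞ fun b : EuclideanSpace ℝ (Fin n) => e b i - e (φ x) i :=
      (contDiff_pi.1 e.contDiff i).sub contDiff_const
    exact h1.contMDiff.comp_contMDiffOn contMDiffOn_extChartAt
  let w : Fin n → C^∞⟮𝓡 n, W; ℝ⟯ := fun i => ⟨_, χ.contMDiff_smul (hcoord i)⟩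
  have hwx : ∀ i, w i x = 0 := fun i => by
    change χ x • (e (φ x) i - e (φ x) i) = 0
    rw [sub_self, smul_zero]
  -- The components of the direction are the values of `D` on the cut-off, centred coordinate
  -- functions.
  refine ⟨∑ i, D (w i) • e.symm (Pi.single i 1), fun s => ?_⟩
  let F : EuclideanSpace ℝ (Fin n) → ℝ := fun b => χ.toContDiffBump b * s (φ.symm b)
  have hF : ContDiff ℝ ∞ F := contDiff_bump_mul_chart χ s.contMDiff
  obtain ⟨g, hg, hga, hFg⟩ := exists_hadamard (hF.comp e.symm.contDiff) (e (φ x))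
  have hgs : ∀ i, ContMDiffOn (𝓡 n) 𝓘(ℝ, ℝ) ∞ (fun y => g i (e (φ y)))
      (chartAt (EuclideanSpace ℝ (Fin n)) x).source := fun i =>
    ((hg i).comp e.contDiff).contMDiff.comp_contMDiffOn contMDiffOn_extChartAt
  let q : Fin n → C^∞⟮𝓡 n, W; ℝ⟯ := fun i => ⟨_, χ.contMDiff_smul (hgs i)⟩
  have hqx : ∀ i, q i x = g i (e (φ x)) := fun i => by
    change χ x • g i (e (φ x)) = _
    rw [χ.eq_one, one_smul]
  have hFx : F (φ x) = s x := by
    change χ.toContDiffBump (φ x) * s (φ.symm (φ x)) = s x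
    rw [χ.toContDiffBump.one_of_mem_closedBall (Metric.mem_closedBall_self χ.rIn_pos.le), one_mul,
      extChartAt_to_inv]
  -- Hadamard's identity for `F`, multiplied by the square of the cut-off. One factor `c` makes `F`
  -- globally defined; the two others are shared between `w i` and `q i`, so that each is a global
  -- smooth function. Applying `D`, with `D c = 0` and `w i x = 0`, leaves `D s = ∑ D (w i) * q i
  -- x`.
  have hid : c * (c * (c * s)) = s x • (c * c) + ∑ i, w i * q i := by
    refine ContMDiffMap.ext fun y => ?_
    have evs : ∀ f : Fin n → C^∞⟮𝓡 n, W; ℝ⟯, (∑ j, f j) y = ∑ j, f j y := fun f =>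
      map_sum (ContMDiffMap.evalRingHom (n := ∞) (I := 𝓡 n) (I' := 𝓘(ℝ, ℝ)) (R := ℝ) y) f _
    change χ y * (χ y * (χ y * s y)) = s x * (χ y * χ y) + (∑ i, w i * q i) y
    rw [evs]
    change _ = _ + ∑ i, (χ y * (e (φ y) i - e (φ x) i)) * (χ y * g i (e (φ y)))
    by_cases hy : y ∈ (chartAt (EuclideanSpace ℝ (Fin n)) x).source
    · have h1 : χ y * s y = F (φ y) := by
        change _ = χ.toContDiffBump (φ y) * s (φ.symm (φ y))
        rw [χ.eqOn_source hy, (extChartAt (𝓡 n) x).left_inv (by rwa [extChartAt_source])]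
        rfl
      have h2 := hFg (e (φ y))
      simp only [Function.comp_apply, ContinuousLinearEquiv.symm_apply_apply] at h2
      rw [h1, h2, hFx, mul_add, mul_add, Finset.mul_sum, Finset.mul_sum]
      congr 1
      · ring
      · exact Finset.sum_congr rfl fun i _ => by ring
    · have : χ y = 0 := Function.notMem_support.1 fun h => hy (χ.support_subset_source h)
      simp [this]
  have hDid := congrArg D hid
  have evm : ∀ f g : C^∞⟮𝓡 n, W; ℝ⟯, (f * g) x = f x * g x := fun _ _ => rfl
  simp only [hD, map_add, map_smul, map_sum, hDc, hcx, hwx, hqx, evm] at hDid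
  simp only [one_mul, zero_mul, mul_one, add_zero, smul_zero, zero_add] at hDid
  rw [hDid, map_sum]
  refine Finset.sum_congr rfl fun i _ => ?_
  rw [map_smul, smul_eq_mul, hga]
  congr 1
  -- The cut-off equals one near the centre, so `F` and `s` in the chart have the same derivative
  -- there.
  have hev : (fun b => s (φ.symm b)) =ᶠ[nhds (φ x)] F := by
    filter_upwards [χ.toContDiffBump.eventuallyEq_one] with b hb
    change _ = χ.toContDiffBump b * _
    rw [hb]
    simp
  rw [hev.fderiv_eq]
  have hFd : DifferentiableAt ℝ F (e.symm (e (φ x))) := hF.differentiable (by simp) _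
  rw [fderiv_comp _ hFd e.symm.differentiableAt, e.symm.fderiv]
  simp

end Manifold

/-! ### Differentiating families of graded functions in a parameter. -/

namespace GradedManifold

variable {N : GradedManifold.{u}}

/-- All coefficients of the functions `g τ`, in all graded coordinates, are differentiable in the
parameter at `t`, with the corresponding coefficients of `g'` as derivatives. -/
def HasFnDerivAt (g : ℝ → N.Fn) (g' : N.Fn) (t : ℝ) : Prop :=
  ∀ (U : Opens N.Body) (ξ : Fin N.rank → N.fn U) (hξ : GradedSpace.IsCoord U N.deg ξ)
    (I : MultiIndex N.deg) (x : U),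
    HasDerivAt (fun τ => hξ.coeffAt I x (N.res le_top (g τ))) (hξ.coeffAt I x (N.res le_top g')) t

/-- Functions that agree in graded coordinates are equal. -/
theorem ext_coeffAt {a b : N.Fn}
    (h : ∀ (U : Opens N.Body) (ξ : Fin N.rank → N.fn U) (hξ : GradedSpace.IsCoord U N.deg ξ)
      (I : MultiIndex N.deg) (x : U),
      hξ.coeffAt I x (N.res le_top a) = hξ.coeffAt I x (N.res le_top b)) : a = b := by
  rw [← sub_eq_zero]
  refine N.separated _ fun x _ => ?_
  obtain ⟨U, hxU, ξ, hξ⟩ := N.exists_coord x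
  refine ⟨U, le_top, hxU, ?_⟩
  rw [map_sub, sub_eq_zero]
  exact hξ.ext_coeffAt (h U ξ hξ)

namespace HasFnDerivAt

variable {g h : ℝ → N.Fn} {g' h' : N.Fn} {t : ℝ}

theorem const (a : N.Fn) (t : ℝ) : HasFnDerivAt (fun _ => a) 0 t := by
  intro U ξ hξ I x
  simpa using hasDerivAt_const t _

theorem add (hg : HasFnDerivAt g g' t) (hh : HasFnDerivAt h h' t) :
    HasFnDerivAt (fun τ => g τ + h τ) (g' + h') t := by
  intro U ξ hξ I x
  simpa only [map_add] using (hg U ξ hξ I x).fun_add (hh U ξ hξ I x)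

theorem sub (hg : HasFnDerivAt g g' t) (hh : HasFnDerivAt h h' t) :
    HasFnDerivAt (fun τ => g τ - h τ) (g' - h') t := by
  intro U ξ hξ I x
  simpa only [map_sub] using (hg U ξ hξ I x).fun_sub (hh U ξ hξ I x)

theorem smul (r : ℝ) (hg : HasFnDerivAt g g' t) : HasFnDerivAt (fun τ => r • g τ) (r • g') t := by
  intro U ξ hξ I x
  simpa only [map_smul, smul_eq_mul] using (hg U ξ hξ I x).const_mul r

/-- The product rule, for a family `g` of functions of fixed degree. -/
theorem mul {i : ℤ} (hgi : ∀ τ, g τ ∈ N.Homog i) (hgi' : g' ∈ N.Homog i)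
    (hg : HasFnDerivAt g g' t) (hh : HasFnDerivAt h h' t) :
    HasFnDerivAt (fun τ => g τ * h τ) (g' * h t + g t * h') t := by
  intro U ξ hξ I x
  -- A coefficient of a product is bilinear in the coefficients of the factors, with structure
  -- constants and finite index sets independent of the parameter. Homogeneity of `a` bounds the
  -- degree of `K`; non-negativity of the degree of `K` then bounds that of `L`.
  have key : ∀ a ∈ N.grading U i, ∀ b : N.fn U, hξ.coeffAt I x (a * b) =
      ∑ K ∈ hξ.indices (I.degree - i), hξ.coeffAt K x b *
        ∑ L ∈ hξ.indices I.degree, hξ.coeffAt L x a *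
          hξ.coeffAt I x (GradedSpace.monomial ξ L * GradedSpace.monomial ξ K) := by
    intro a ha b
    have h1 := hξ.apply_eq_sum_indices (hξ.coeffAt I x ∘ₗ LinearMap.mulLeft ℝ a) (I.degree - i)
      (fun k hk b hb => hξ.coeffAt_eq_zero_of_mem (N.mul_mem ha hb) (by omega) x) b
    refine h1.trans (Finset.sum_congr rfl fun K _ => ?_)
    simp only [LinearMap.comp_apply, LinearMap.mulLeft_apply]
    rw [← mul_assoc, ← GradedSpace.ofSmooth_mul_comm, mul_assoc, hξ.coeffAt_ofSmooth_mul]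
    congr 1
    have h2 := hξ.apply_eq_sum_indices
      (hξ.coeffAt I x ∘ₗ LinearMap.mulRight ℝ (GradedSpace.monomial ξ K)) I.degree
      (fun k hk b hb => by
        have := K.degree_nonneg hξ.deg_pos
        exact hξ.coeffAt_eq_zero_of_mem
          (N.mul_mem hb (GradedSpace.monomial_mem_grading hξ.mem K)) (by omega) x) a
    refine h2.trans (Finset.sum_congr rfl fun L _ => ?_)
    simp only [LinearMap.comp_apply, LinearMap.mulRight_apply]
    rw [mul_assoc, hξ.coeffAt_ofSmooth_mul]
    rfl
  have hr : ∀ τ, N.res (le_top : U ≤ ⊤) (g τ) ∈ N.grading U i := fun τ => N.res_mem _ (hgi τ)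
  have hr' : N.res (le_top : U ≤ ⊤) g' ∈ N.grading U i := N.res_mem _ hgi'
  simp only [map_add, map_mul]
  simp only [key _ (hr _), key _ hr']
  rw [← Finset.sum_add_distrib]
  refine HasDerivAt.fun_sum fun K _ => ?_
  refine ((hh U ξ hξ K x).mul (HasDerivAt.fun_sum fun L _ =>
    (hg U ξ hξ L x).mul_const _)).congr_deriv ?_
  ring

/-- A family of functions with vanishing derivative is constant. -/
theorem eq_of_zero {J : Set ℝ} (hJ : IsOpen J) (hJ' : J.OrdConnected)
    (hg : ∀ t ∈ J, HasFnDerivAt g 0 t) {s t : ℝ} (hs : s ∈ J) (ht : t ∈ J) : g s = g t := by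
  refine ext_coeffAt fun U ξ hξ I x => ?_
  have hd : ∀ τ ∈ J, HasDerivAt (fun τ => hξ.coeffAt I x (N.res le_top (g τ))) 0 τ := fun τ hτ => by
    simpa using hg τ hτ U ξ hξ I x
  exact hJ.is_const_of_deriv_eq_zero hJ'.isPreconnected
    (fun τ hτ => (hd τ hτ).differentiableAt.differentiableWithinAt) (fun τ hτ => (hd τ hτ).deriv)
    hs ht

end HasFnDerivAt

/-- In graded coordinates, a vector field acts on coefficients by first order operators. -/
theorem exists_firstOrder {k : ℤ} (X : VF N k) {U : Opens N.Body} {ξ : Fin N.rank → N.fn U}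
    (hξ : GradedSpace.IsCoord U N.deg ξ) (I : MultiIndex N.deg) (x : U) (a : N.fn U) :
    ∃ (v : EuclideanSpace ℝ (Fin N.dim)) (r : ℝ), ∀ s : N.Sm U,
      hξ.coeffAt I x (X.1 U (N.ofSmooth U s * a)) =
        fderiv ℝ (fun b => s ((extChartAt (𝓡 N.dim) x).symm b)) (extChartAt (𝓡 N.dim) x x) v +
          s x * r := by
  let D : N.Sm U →ₗ[ℝ] ℝ := hξ.coeffAt I x ∘ₗ LinearMap.mulRight ℝ a ∘ₗ X.1 U ∘ₗ
    (N.ofSmooth U).toLinearMap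
  have hDs : ∀ s, D s = hξ.coeffAt I x (X.1 U (N.ofSmooth U s) * a) := fun _ => rfl
  -- The Leibniz rule on body functions carries no sign, so `s ↦ coeff (X s * a)` is an ordinary
  -- point derivation. The remaining term `s * X a` accounts for the zeroth order part `r`.
  obtain ⟨v, hv⟩ := exists_direction_of_pointDerivation x D fun f g => by
    rw [hDs, hDs, hDs, map_mul (N.ofSmooth U), X.2.leibniz _ (N.ofSmooth_mem f),
      ← GradedSpace.ofSmooth_mul_comm]
    simp only [mul_zero, zpow_zero, one_smul, add_mul, map_add, mul_assoc,
      hξ.coeffAt_ofSmooth_mul]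
    ring
  refine ⟨v, hξ.coeffAt I x (X.1 U a), fun s => ?_⟩
  rw [← hv, hDs, X.2.leibniz _ (N.ofSmooth_mem s)]
  simp only [mul_zero, zpow_zero, one_smul, map_add, hξ.coeffAt_ofSmooth_mul]

/-- Vector fields commute with differentiation in a parameter. -/
theorem HasFnDerivAt.vf_apply {J : Set ℝ} (hJ : IsOpen J) {g g' : ℝ → N.Fn}
    (hs : ∀ (U : Opens N.Body) (ξ : Fin N.rank → N.fn U) (hξ : GradedSpace.IsCoord U N.deg ξ)
      (I : MultiIndex N.deg), ContMDiffOn (𝓘(ℝ, ℝ).prod (𝓡 N.dim)) 𝓘(ℝ, ℝ) ∞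
      (fun p : ℝ × U => hξ.coeffAt I p.2 (N.res le_top (g p.1))) (J ×ˢ Set.univ))
    (hg : ∀ t ∈ J, HasFnDerivAt g (g' t) t) {k : ℤ} (X : VF N k) {t : ℝ} (ht : t ∈ J) :
    HasFnDerivAt (fun τ => X.1 ⊤ (g τ)) (X.1 ⊤ (g' t)) t := by
  intro U ξ hξ I x
  choose v r hvr using fun L => exists_firstOrder X hξ I x (GradedSpace.monomial ξ L)
  -- As `X` shifts degrees by `k`, only coefficients of degree at most `I.degree - k` reach the
  -- exponent `I`, so finitely many first order operators suffice.
  have key : ∀ a : N.fn U, hξ.coeffAt I x (X.1 U a) = ∑ L ∈ hξ.indices (I.degree - k),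
      (fderiv ℝ (fun b => hξ.coeffAt L ((extChartAt (𝓡 N.dim) x).symm b) a)
        (extChartAt (𝓡 N.dim) x x) (v L) + hξ.coeffAt L x a * r L) := by
    intro a
    have h1 := hξ.apply_eq_sum_indices (hξ.coeffAt I x ∘ₗ X.1 U) (I.degree - k)
      (fun j hj b hb => hξ.coeffAt_eq_zero_of_mem (X.2.mem hb) (by omega) x) a
    exact h1.trans (Finset.sum_congr rfl fun L _ => hvr L _)
  simp only [X.2.res, key]
  refine HasDerivAt.fun_sum fun L _ => ?_
  refine HasDerivAt.add ?_ ((hg t ht U ξ hξ L x).mul_const _)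
  exact hasDerivAt_fderiv_chart hJ
    (s' := fun p : ℝ × U => hξ.coeffAt L p.2 (N.res le_top (g' p.1))) (hs U ξ hξ L)
    (fun τ hτ y => hg τ hτ U ξ hξ L y) ht x (v L)

end GradedManifold

/-! ### Leibniz rules for `d`, contraction and Lie derivative. -/

namespace Form

variable {M : GradedManifold.{u}}

/-- Differential forms are built from `1` by linear combinations and left multiplication by
functions and their differentials. -/
theorem induction_left {P : Form M → Prop} (one : P 1) (add : ∀ α β, P α → P β → P (α + β))
    (smul : ∀ (r : ℝ) β, P β → P (r • β))
    (fn_mul : ∀ (i : ℤ) (h : M.Homog i) β, P β → P (fn h * β))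
    (dfn_mul : ∀ (i : ℤ) (h : M.Homog i) β, P β → P (dfn h * β)) (α : Form M) : P α := by
  obtain ⟨x, rfl⟩ := RingQuot.mkAlgHom_surjective ℝ (FormRel M) α
  -- Stability under left multiplication is the form of the claim that passes through products in
  -- the free algebra.
  suffices h : ∀ β, P β → P (mk M x * β) by
    have h1 := h 1 one
    rwa [mul_one] at h1
  induction x using FreeAlgebra.induction with
  | grade0 r =>
    intro β hβ
    rw [AlgHom.commutes, ← Algebra.smul_def]
    exact smul r β hβ
  | grade1 x =>
    cases x with
    | fn i h => exact fn_mul i h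
    | d i h => exact dfn_mul i h
  | mul x y hx hy =>
    intro β hβ
    rw [map_mul, mul_assoc]
    exact hx _ (hy _ hβ)
  | add x y hx hy =>
    intro β hβ
    rw [map_add, add_mul]
    exact add _ _ (hx _ hβ) (hy _ hβ)

section Derivation

variable {k : ℤ} {D₀ D₁ : ∀ i : ℤ, M.Homog i → Form M} (H : IsDerData k D₀ D₁)

theorem lift_derGen_fn {i : ℤ} (h : M.Homog i) : lift (derGen k D₀ D₁) (derGen_rel H) (fn h) =
    !![(-1 : ℝ) ^ (k * i) • fn h, D₀ i h; 0, fn h] := by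
  rw [fn, lift_mk, derGen_f]
  rfl

theorem lift_derGen_dfn {i : ℤ} (h : M.Homog i) : lift (derGen k D₀ D₁) (derGen_rel H) (dfn h) =
    !![(-1 : ℝ) ^ (k * (i + 1)) • dfn h, D₁ i h; 0, dfn h] := by
  rw [dfn, lift_mk, derGen_df]
  rfl

/-- The matrices are upper triangular, so the lower right entry is multiplicative, and it is the
identity on generators. The upper right entry of a product thus reads `± x D y + D x y`. With a
generator on the left the sign needs only the degree of that generator, so the other factor need not
be homogeneous. -/
theorem lift_derGen_one_one (β : Form M) : lift (derGen k D₀ D₁) (derGen_rel H) β 1 1 = β := by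
  induction β using induction_left with
  | one => simp
  | add α β hα hβ => rw [map_add, Matrix.add_apply, hα, hβ]
  | smul r β hβ => rw [map_smul, Matrix.smul_apply, hβ]
  | fn_mul i h β hβ =>
    rw [map_mul, lift_derGen_fn H, Matrix.mul_apply, Fin.sum_univ_two, hβ]
    simp
  | dfn_mul i h β hβ =>
    rw [map_mul, lift_derGen_dfn H, Matrix.mul_apply, Fin.sum_univ_two, hβ]
    simp

theorem derivation_apply (β : Form M) :
    derivation H β = lift (derGen k D₀ D₁) (derGen_rel H) β 0 1 := rfl

theorem derivation_one : derivation H 1 = 0 := by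
  rw [derivation_apply, map_one]
  simp

theorem derivation_fn_mul {i : ℤ} (h : M.Homog i) (β : Form M) : derivation H (fn h * β) =
    D₀ i h * β + (-1 : ℝ) ^ (k * i) • (fn h * derivation H β) := by
  rw [derivation_apply, map_mul, lift_derGen_fn H, Matrix.mul_apply, Fin.sum_univ_two,
    lift_derGen_one_one H, ← derivation_apply H]
  simp [add_comm]

theorem derivation_dfn_mul {i : ℤ} (h : M.Homog i) (β : Form M) : derivation H (dfn h * β) =
    D₁ i h * β + (-1 : ℝ) ^ (k * (i + 1)) • (dfn h * derivation H β) := by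
  rw [derivation_apply, map_mul, lift_derGen_dfn H, Matrix.mul_apply, Fin.sum_univ_two,
    lift_derGen_one_one H, ← derivation_apply H]
  simp [add_comm]

end Derivation

theorem d_one : d (1 : Form M) = 0 := derivation_one _

theorem d_fn_mul {i : ℤ} (h : M.Homog i) (β : Form M) :
    d (fn h * β) = dfn h * β + (-1 : ℝ) ^ i • (fn h * d β) := by
  rw [d, derivation_fn_mul, one_mul]

theorem d_dfn_mul {i : ℤ} (h : M.Homog i) (β : Form M) :
    d (dfn h * β) = (-1 : ℝ) ^ (i + 1) • (dfn h * d β) := by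
  rw [d, derivation_dfn_mul, one_mul, zero_mul, zero_add]

section Contract

variable {k : ℤ} (X : VF M k)

theorem contract_one : contract X 1 = 0 := derivation_one _

theorem contract_fn_mul {i : ℤ} (h : M.Homog i) (β : Form M) :
    contract X (fn h * β) = (-1 : ℝ) ^ ((k - 1) * i) • (fn h * contract X β) := by
  rw [contract, derivation_fn_mul, zero_mul, zero_add]

theorem contract_dfn_mul {i : ℤ} (h : M.Homog i) (β : Form M) : contract X (dfn h * β) =
    fn (VF.app X h) * β + (-1 : ℝ) ^ ((k - 1) * (i + 1)) • (dfn h * contract X β) :=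
  derivation_dfn_mul (isDerData_contract X) h β

theorem lieDeriv_apply (β : Form M) :
    lieDeriv X β = contract X (d β) + (-1 : ℝ) ^ k • d (contract X β) := rfl

theorem lieDeriv_one : lieDeriv X 1 = 0 := by
  rw [lieDeriv_apply, d_one, contract_one, map_zero, map_zero, smul_zero, add_zero]

/-- The two cross terms `dh · ι_X β`, one from `ι_X d` and one from `d ι_X`, have opposite signs
(`e1`); what remains is the Leibniz rule in degree `k`. -/
theorem lieDeriv_fn_mul {i : ℤ} (h : M.Homog i) (β : Form M) : lieDeriv X (fn h * β) =
    fn (VF.app X h) * β + (-1 : ℝ) ^ (k * i) • (fn h * lieDeriv X β) := by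
  simp only [lieDeriv_apply, d_fn_mul, map_add, map_smul, contract_fn_mul, contract_dfn_mul,
    smul_add, mul_add (R := Form M), mul_smul_comm, smul_smul, neg_one_zpow_mul]
  have e1 : (-1 : ℝ) ^ ((k - 1) * (i + 1)) = -(-1 : ℝ) ^ (k + (k - 1) * i) := by
    rw [neg_one_zpow_congr (i := (k - 1) * (i + 1)) (j := (k + (k - 1) * i) + 1)
      ⟨-1, by ring⟩, ← neg_one_zpow_mul]
    simp
  rw [e1, neg_one_zpow_congr (i := i + (k - 1) * i) (j := k * i) ⟨0, by ring⟩,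
    neg_one_zpow_congr (i := k + ((k - 1) * i + i)) (j := k * i + k) ⟨0, by ring⟩, neg_smul]
  abel

/-- Here the cross terms are `X(h) · dβ`, again with opposite signs. The factor `(-1)^k` expresses
that `L_X` and `d` commute in the graded sense. -/
theorem lieDeriv_dfn_mul {i : ℤ} (h : M.Homog i) (β : Form M) : lieDeriv X (dfn h * β) =
    (-1 : ℝ) ^ k • (dfn (VF.app X h) * β) +
      (-1 : ℝ) ^ (k * (i + 1)) • (dfn h * lieDeriv X β) := by
  simp only [lieDeriv_apply, d_fn_mul, d_dfn_mul, map_add, map_smul, contract_dfn_mul,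
    smul_add, mul_add (R := Form M), mul_smul_comm, smul_smul, neg_one_zpow_mul]
  have e1 : (-1 : ℝ) ^ (k + (i + k)) = -(-1 : ℝ) ^ (i + 1) := by
    rw [neg_one_zpow_congr (i := k + (i + k)) (j := (i + 1) + 1)
      ⟨k - 1, by ring⟩, ← neg_one_zpow_mul]
    simp
  rw [e1, neg_one_zpow_congr (i := i + 1 + (k - 1) * (i + 1)) (j := k * (i + 1)) ⟨0, by ring⟩,
    neg_one_zpow_congr (i := k + ((k - 1) * (i + 1) + (i + 1))) (j := k * (i + 1) + k)
      ⟨0, by ring⟩, neg_smul]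
  abel

end Contract

end Form

/-! ### The morphism `f^*` on generators and its compatibility with Q-morphisms. -/

namespace GMor

variable {L M N : GradedManifold.{u}}

theorem pullTop_comp (ψ : GMor M N) (φ : GMor L M) (a : N.Fn) :
    (ψ.comp φ).pullTop a = φ.pullTop (ψ.pullTop a) := rfl

theorem pullForm_fn (φ : GMor M N) {i : ℤ} (h : N.Homog i) :
    φ.pullForm (Form.fn h) = Form.fn (φ.pullHom h) := by
  rw [pullForm, Form.fn, Form.lift_mk]
  simp [FormGen.f, pullFormGen]

theorem pullForm_dfn (φ : GMor M N) {i : ℤ} (h : N.Homog i) :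
    φ.pullForm (Form.dfn h) = Form.dfn (φ.pullHom h) := by
  rw [pullForm, Form.dfn, Form.lift_mk]
  simp [FormGen.df, pullFormGen]

end GMor

namespace QManifold

variable {L M N : QManifold.{u}}

theorem fStar_fn (φ : GMor M.toGradedManifold N.toGradedManifold) {i : ℤ} (h : N.Homog i) :
    fStar φ (Form.fn h) = φ.pullTop h.1 := by
  rw [fStar, Form.fn, Form.lift_mk]
  simp [FormGen.f, fGen]

theorem fStar_dfn (φ : GMor M.toGradedManifold N.toGradedManifold) {i : ℤ} (h : N.Homog i) :
    fStar φ (Form.dfn h) = fieldStrength φ h.1 := by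
  rw [fStar, Form.dfn, Form.lift_mk]
  simp [FormGen.df, fGen]

theorem fieldStrength_pullTop {ρ : GMor M.toGradedManifold N.toGradedManifold}
    (hρ : IsQMorphism ρ) (φ : GMor L.toGradedManifold M.toGradedManifold) (a : N.Fn) :
    fieldStrength φ (ρ.pullTop a) = fieldStrength (ρ.comp φ) a := by
  have h : M.Q.1 ⊤ (ρ.pullTop a) = ρ.pullTop (N.Q.1 ⊤ a) := hρ _ _ _ _
  rw [fieldStrength_apply, fieldStrength_apply, h, GMor.pullTop_comp, GMor.pullTop_comp]

/-- Because `ρ` intertwines the homological vector fields, the field strength of `φ` on `ρ^* h` is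
that of `ρ ∘ φ` on `h`. The invariance problem thereby moves from `M` to forms on `M₂`. -/
theorem fStar_pullForm {ρ : GMor M.toGradedManifold N.toGradedManifold} (hρ : IsQMorphism ρ)
    (φ : GMor L.toGradedManifold M.toGradedManifold) (α : Form N.toGradedManifold) :
    fStar φ (ρ.pullForm α) = fStar (ρ.comp φ) α := by
  induction α using Form.induction_left with
  | one => simp
  | add α β hα hβ => simp only [map_add, hα, hβ]
  | smul r β hβ => simp only [map_smul, hβ]
  | fn_mul i h β hβ =>
    rw [map_mul, map_mul, map_mul, hβ, GMor.pullForm_fn, fStar_fn, fStar_fn]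
    rfl
  | dfn_mul i h β hβ =>
    rw [map_mul, map_mul, map_mul, hβ, GMor.pullForm_dfn, fStar_dfn, fStar_dfn,
      ← fieldStrength_pullTop hρ]
    rfl

variable (φ : GMor M.toGradedManifold N.toGradedManifold)

/-- `c f^* ∘ L_X`, for `c` and `X` of opposite degrees, is a derivation along `f^*`. -/
theorem mul_fStar_lieDeriv_fn_mul {p q : ℤ} (hpq : p + q = 0) {c : M.Fn} (hc : c ∈ M.Homog p)
    (X : VF N.toGradedManifold q) {i : ℤ} (h : N.Homog i) (β : Form N.toGradedManifold) :
    c * fStar φ (Form.lieDeriv X (Form.fn h * β)) =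
      c * φ.pullTop (X.1 ⊤ h.1) * fStar φ β +
        φ.pullTop h.1 * (c * fStar φ (Form.lieDeriv X β)) := by
  have hh : φ.pullTop h.1 ∈ M.Homog i := φ.pull_mem _ h.2
  -- Moving `c` past `h` gives `(-1)^(p i)`, which cancels the `(-1)^(q i)` of the Lie derivative
  -- since `p + q = 0`.
  rw [Form.lieDeriv_fn_mul, map_add, map_smul, map_mul, map_mul, fStar_fn, fStar_fn, mul_add,
    mul_smul_comm, ← mul_assoc, ← mul_assoc, ← mul_assoc, M.graded_comm hc hh,
    smul_mul_assoc, smul_smul, neg_one_zpow_mul, ← add_mul, add_comm q p, hpq, zero_mul, zpow_zero,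
    one_smul]
  rfl

/-- The same cancellation of signs, for a generator of total degree `i + 1`. The surviving `(-1)^q`
comes from commuting `L_X` with `d`. -/
theorem mul_fStar_lieDeriv_dfn_mul {p q : ℤ} (hpq : p + q = 0) {c : M.Fn} (hc : c ∈ M.Homog p)
    (X : VF N.toGradedManifold q) {i : ℤ} (h : N.Homog i) (β : Form N.toGradedManifold) :
    c * fStar φ (Form.lieDeriv X (Form.dfn h * β)) =
      (-1 : ℝ) ^ q • (c * fieldStrength φ (X.1 ⊤ h.1)) * fStar φ β +
        fieldStrength φ h.1 * (c * fStar φ (Form.lieDeriv X β)) := by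
  rw [Form.lieDeriv_dfn_mul, map_add, map_smul, map_smul, map_mul, map_mul, fStar_dfn, fStar_dfn,
    mul_add, mul_smul_comm, mul_smul_comm, ← mul_assoc, ← mul_assoc, ← mul_assoc,
    M.graded_comm hc (fieldStrength_mem φ h.2),
    smul_mul_assoc, smul_mul_assoc, smul_smul, neg_one_zpow_mul, ← add_mul, add_comm q p, hpq,
    zero_mul, zpow_zero, one_smul]
  rfl

end QManifold

/-! ### Infinitesimal gauge transformations. -/

theorem VF.bracket_apply {M : GradedManifold.{u}} {k l : ℤ} (X : VF M k) (Y : VF M l)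
    (U : Opens M.Body) (a : M.fn U) : (VF.bracket X Y).1 U a =
      X.1 U (Y.1 U a) - (-1 : ℝ) ^ (k * l) • Y.1 U (X.1 U a) := rfl

theorem IsSection.pullTop_pullTop {M₁ M : GradedManifold.{u}} {π : GMor M M₁} {φ : GMor M₁ M}
    (h : IsSection π φ) (b : M₁.Fn) : φ.pullTop (π.pullTop b) = b := by
  rw [← GMor.pullTop_comp, show π.comp φ = GMor.id M₁ from h]
  exact M₁.res_self b

section TrivialBundle

variable {M₁ M₂ M : QManifold.{u}} {π : GMor M.toGradedManifold M₁.toGradedManifold}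
  {ρ : GMor M.toGradedManifold M₂.toGradedManifold}

/-- The infinitesimal gauge transformation of a section with parameter `b Y`. -/
theorem pullTop_bracket_apply (hM : IsTrivialQBundle π ρ)
    {φ : GMor M₁.toGradedManifold M.toGradedManifold} (hφ : IsSection π φ)
    {i j : ℤ} (hij : i + j = -1) (b : M₁.Homog i) (Y : VF M₂.toGradedManifold j)
    {Y' : VF M.toGradedManifold j} (hY : IsVerticalLift π ρ Y Y') {Z : VF M.toGradedManifold (-1)}
    (hZ : ∀ (U : Opens M.Body) (a : M.fn U),
      Z.1 U a = M.res le_top (π.pullTop b.1) * Y'.1 U a) (h : M₂.Fn) :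
    φ.pullTop ((VF.bracket M.Q Z).1 ⊤ (ρ.pullTop h)) =
      M₁.Q.1 ⊤ b.1 * (ρ.comp φ).pullTop (Y.1 ⊤ h) +
        (-1 : ℝ) ^ i • (b.1 * (ρ.comp φ).pullTop ((VF.bracket M₂.Q Y).1 ⊤ h)) := by
  have hZρ : ∀ a, Z.1 ⊤ (ρ.pullTop a) = π.pullTop b.1 * ρ.pullTop (Y.1 ⊤ a) := fun a => by
    rw [hZ, M.res_self]
    exact congrArg _ (hY.snd _ _ _ a)
  have hQρ : ∀ a, M.Q.1 ⊤ (ρ.pullTop a) = ρ.pullTop (M₂.Q.1 ⊤ a) :=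
    fun a => hM.isQMorphism_snd _ _ _ a
  have hQπ : ∀ a, M.Q.1 ⊤ (π.pullTop a) = π.pullTop (M₁.Q.1 ⊤ a) :=
    fun a => hM.isQMorphism_fst _ _ _ a
  have hb : π.pullTop b.1 ∈ M.Homog i := π.pull_mem _ b.2
  -- On `ρ^* h` the bracket is `QZ + ZQ`. The total degree `-1` gives the term `b Y Q₂` exactly the
  -- sign it needs to complete `(-1)^i b Q₂ Y` to `(-1)^i b [Q₂, Y]`.
  have hs : (-1 : ℝ) ^ i * (-1 : ℝ) ^ j = -1 := by rw [neg_one_zpow_mul, hij]; norm_num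
  simp only [VF.bracket_apply, hZρ, hQρ, hQπ, M.Q.2.leibniz _ hb, map_sub, map_add, map_smul,
    map_mul, hφ.pullTop_pullTop, GMor.pullTop_comp, mul_sub, smul_sub, mul_smul_comm, smul_smul,
    one_mul, hs]
  norm_num
  abel

/-- The infinitesimal gauge transformation of the field strength, with parameter `b Y`. -/
theorem fieldStrength_variation (hM : IsTrivialQBundle π ρ)
    {φ : GMor M₁.toGradedManifold M.toGradedManifold} (hφ : IsSection π φ)
    {i j : ℤ} (hij : i + j = -1) (b : M₁.Homog i) (Y : VF M₂.toGradedManifold j)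
    {Y' : VF M.toGradedManifold j} (hY : IsVerticalLift π ρ Y Y') {Z : VF M.toGradedManifold (-1)}
    (hZ : ∀ (U : Opens M.Body) (a : M.fn U),
      Z.1 U a = M.res le_top (π.pullTop b.1) * Y'.1 U a) (h : M₂.Fn) :
    M₁.Q.1 ⊤ (φ.pullTop ((VF.bracket M.Q Z).1 ⊤ (ρ.pullTop h))) -
        φ.pullTop ((VF.bracket M.Q Z).1 ⊤ (ρ.pullTop (M₂.Q.1 ⊤ h))) =
      (-1 : ℝ) ^ j • (M₁.Q.1 ⊤ b.1 * QManifold.fieldStrength (ρ.comp φ) (Y.1 ⊤ h)) +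
        (-1 : ℝ) ^ i • ((-1 : ℝ) ^ (1 + j) •
          (b.1 * QManifold.fieldStrength (ρ.comp φ) ((VF.bracket M₂.Q Y).1 ⊤ h))) := by
  -- All signs are reduced to `(-1)^i` by means of `i + j = -1`.
  have hj : (-1 : ℝ) ^ j = -(-1 : ℝ) ^ i := by
    rw [neg_one_zpow_congr (i := j) (j := i + 1) ⟨-1 - i, by linarith⟩, ← neg_one_zpow_mul]
    simp
  have hs : (-1 : ℝ) ^ i * (-1 : ℝ) ^ i = 1 := by
    rw [neg_one_zpow_mul, Even.neg_one_zpow ⟨i, rfl⟩]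
  have hj1 : (-1 : ℝ) ^ (1 + j) = (-1 : ℝ) ^ i := by
    rw [← neg_one_zpow_mul, hj]; simp
  have hi1 : (-1 : ℝ) ^ (i + 1) = -(-1 : ℝ) ^ i := by
    rw [← neg_one_zpow_mul]; simp
  rw [pullTop_bracket_apply hM hφ hij b Y hY hZ, pullTop_bracket_apply hM hφ hij b Y hY hZ]
  -- Apply `Q₁` to the formula for `h` and subtract the formula for `Q₂ h`. The terms in `Q₁² b` and
  -- `Q₂²` vanish, and the two terms `Q₁b · a^*(Y Q₂ h)`, with `a = ρ ∘ φ`, cancel; the rest groups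
  -- into field strengths of `Y h` and `[Q₂, Y] h`.
  simp only [map_add, map_smul, M₁.Q.2.leibniz _ (M₁.Q.2.mem b.2), M₁.Q.2.leibniz _ b.2, M₁.Q_sq,
    VF.bracket_apply, M₂.Q_sq, map_sub, map_zero, QManifold.fieldStrength_apply, one_mul, hj, hj1,
    hi1, mul_sub, smul_sub, smul_add, mul_smul_comm, smul_smul, hs, neg_smul,
    sub_neg_eq_add, mul_add, one_smul, zero_mul, smul_zero, mul_zero]
  abel

/-- Every gauge parameter defines a derivation along `f^*` which is the variation of `f^*` under the
corresponding infinitesimal gauge transformation, and which annihilates basic forms. -/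
theorem exists_variation (hM : IsTrivialQBundle π ρ) {G : HolonomyAlgebra M₂}
    {α : Form M₂.toGradedManifold} (hα : G.IsBasic α)
    {φ : GMor M₁.toGradedManifold M.toGradedManifold} (hφ : IsSection π φ)
    {Z : VF M.toGradedManifold (-1)} (hZ : Z ∈ gaugeParameters π ρ G (-1)) :
    ∃ δ : Form M₂.toGradedManifold →ₗ[ℝ] M₁.Fn, δ 1 = 0 ∧
      (∀ (i : ℤ) (h : M₂.Homog i) β, δ (Form.fn h * β) =
        φ.pullTop ((VF.bracket M.Q Z).1 ⊤ (ρ.pullTop h.1)) * QManifold.fStar (ρ.comp φ) β +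
          (ρ.comp φ).pullTop h.1 * δ β) ∧
      (∀ (i : ℤ) (h : M₂.Homog i) β, δ (Form.dfn h * β) =
        (M₁.Q.1 ⊤ (φ.pullTop ((VF.bracket M.Q Z).1 ⊤ (ρ.pullTop h.1))) -
          φ.pullTop ((VF.bracket M.Q Z).1 ⊤ (ρ.pullTop (M₂.Q.1 ⊤ h.1)))) *
            QManifold.fStar (ρ.comp φ) β +
          QManifold.fieldStrength (ρ.comp φ) h.1 * δ β) ∧
      δ α = 0 := by
  have hadd : ∀ (x y : VF M.toGradedManifold (-1)) (a : M.Fn), (VF.bracket M.Q (x + y)).1 ⊤ a =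
      (VF.bracket M.Q x).1 ⊤ a + (VF.bracket M.Q y).1 ⊤ a := fun x y a => by
    simp only [VF.bracket_apply, Submodule.coe_add, Pi.add_apply, LinearMap.add_apply, map_add,
      smul_add]
    abel
  have hsmul : ∀ (r : ℝ) (x : VF M.toGradedManifold (-1)) (a : M.Fn),
      (VF.bracket M.Q (r • x)).1 ⊤ a = r • (VF.bracket M.Q x).1 ⊤ a := fun r x a => by
    simp only [VF.bracket_apply, Submodule.coe_smul, Pi.smul_apply, LinearMap.smul_apply, map_smul,
      smul_sub, smul_comm r]
  have hzero : ∀ a : M.Fn, (VF.bracket M.Q (0 : VF M.toGradedManifold (-1))).1 ⊤ a = 0 :=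
    fun a => by simpa using hsmul 0 0 a
  -- All conditions on `δ` are linear in the pair `(Z, δ)`, so only a single product `b Y` carries
  -- content.
  induction hZ using Submodule.span_induction with
  | zero => exact ⟨0, by simp, by simp [hzero], by simp [hzero], by simp⟩
  | add x y _ _ hx hy =>
    obtain ⟨δ, h1, h2, h3, h4⟩ := hx
    obtain ⟨δ', h1', h2', h3', h4'⟩ := hy
    refine ⟨δ + δ', ?_, fun i h β => ?_, fun i h β => ?_, ?_⟩
    · rw [LinearMap.add_apply, h1, h1', add_zero]
    · simp only [LinearMap.add_apply, h2, h2', hadd, map_add, add_mul, mul_add]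
      abel
    · simp only [LinearMap.add_apply, h3, h3', hadd, map_add, add_mul, mul_add, sub_mul]
      abel
    · rw [LinearMap.add_apply, h4, h4', add_zero]
  | smul r x _ hx =>
    obtain ⟨δ, h1, h2, h3, h4⟩ := hx
    refine ⟨r • δ, ?_, fun i h β => ?_, fun i h β => ?_, ?_⟩
    · rw [LinearMap.smul_apply, h1, smul_zero]
    · simp only [LinearMap.smul_apply, h2, hsmul, map_smul, smul_add, smul_mul_assoc,
        mul_smul_comm]
    · simp only [LinearMap.smul_apply, h3, hsmul, map_smul, smul_add, smul_sub, smul_mul_assoc,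
        mul_smul_comm, sub_mul]
    · rw [LinearMap.smul_apply, h4, smul_zero]
  | mem Z hZ =>
    obtain ⟨i, j, b, Y, Y', hij, hYG, hY, hZ⟩ := hZ
    have hQb : M₁.Q.1 ⊤ b.1 ∈ M₁.Homog (i + 1) := M₁.Q.2.mem b.2
    have e1 : i + 1 + j = 0 := by omega
    have e2 : i + (1 + j) = 0 := by omega
    let η := fun {q : ℤ} (c : M₁.Fn) (X : VF M₂.toGradedManifold q) =>
      LinearMap.mulLeft ℝ c ∘ₗ (QManifold.fStar (ρ.comp φ)).toLinearMap ∘ₗ Form.lieDeriv X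
    have hη : ∀ {q : ℤ} (c : M₁.Fn) (X : VF M₂.toGradedManifold q) β,
      η c X β = c * QManifold.fStar (ρ.comp φ) (Form.lieDeriv X β) := fun _ _ _ => rfl
    -- The variation is `(Q₁b) f^* L_Y + (-1)^i b f^* L_{[Q₂,Y]}`. Both terms pair opposite degrees
    -- (`e1`, `e2`), and they are precisely the Lie derivatives that vanish on basic forms.
    refine ⟨η (M₁.Q.1 ⊤ b.1) Y + (-1 : ℝ) ^ i • η b.1 (VF.bracket M₂.Q Y), ?_, fun l h β => ?_,
      fun l h β => ?_, ?_⟩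
    · simp [hη, Form.lieDeriv_one]
    · rw [pullTop_bracket_apply hM hφ hij b Y hY hZ]
      simp only [LinearMap.add_apply, LinearMap.smul_apply, hη]
      rw [QManifold.mul_fStar_lieDeriv_fn_mul _ e1 hQb,
        QManifold.mul_fStar_lieDeriv_fn_mul _ e2 b.2]
      simp only [smul_add, add_mul, mul_add, smul_mul_assoc, mul_smul_comm]
      abel
    · rw [fieldStrength_variation hM hφ hij b Y hY hZ]
      simp only [LinearMap.add_apply, LinearMap.smul_apply, hη]
      rw [QManifold.mul_fStar_lieDeriv_dfn_mul _ e1 hQb,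
        QManifold.mul_fStar_lieDeriv_dfn_mul _ e2 b.2]
      simp only [smul_add, add_mul, mul_add, smul_mul_assoc, mul_smul_comm]
      abel
    · obtain ⟨h1, h2⟩ := hα j Y hYG
      simp [hη, h1, h2]

/-- The function `f^*(ρ^* α)` is constant along integral families of sections. -/
theorem fStar_eq_of_isIntegralFamily (hM : IsTrivialQBundle π ρ) {G : HolonomyAlgebra M₂}
    {α : Form M₂.toGradedManifold} (hα : G.IsBasic α) {X : VF M.toGradedManifold 0}
    (hX : X ∈ gaugeAlgebra π ρ G) {J : Set ℝ} (hJ : IsOpen J) (hJ' : J.OrdConnected)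
    {Φ : ℝ → GMor M₁.toGradedManifold M.toGradedManifold} (hΦ : ∀ t ∈ J, IsSection π (Φ t))
    (hX' : IsIntegralFamily J Φ X) {s t : ℝ} (hs : s ∈ J) (ht : t ∈ J) :
    QManifold.fStar (Φ s) (ρ.pullForm α) = QManifold.fStar (Φ t) (ρ.pullForm α) := by
  obtain ⟨Z, hZ, hXZ⟩ := hX
  simp only [QManifold.fStar_pullForm hM.isQMorphism_snd]
  refine GradedManifold.HasFnDerivAt.eq_of_zero
    (g := fun τ => QManifold.fStar (ρ.comp (Φ τ)) α) hJ hJ' (fun t ht => ?_) hs ht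
  obtain ⟨δ, h1, h2, h3, h4⟩ := exists_variation hM hα (hΦ t ht) hZ
  rw [← hXZ] at h2 h3
  -- The zero derivative is rewritten as `δ α`: the statement for an arbitrary form `β`, with
  -- derivative `δ β`, can be proved by induction on generators.
  rw [← h4]
  have hpull : ∀ t ∈ J, ∀ h : M.Fn, GradedManifold.HasFnDerivAt (fun τ => (Φ τ).pullTop h)
      ((Φ t).pullTop (X.1 ⊤ h)) t := fun t ht h U ξ hξ I x => hX'.hasDerivAt h U ξ hξ I t ht x
  have hXmem : ∀ {i : ℤ} {a : M.Fn}, a ∈ M.Homog i → X.1 ⊤ a ∈ M.Homog i := fun {i a} ha => by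
    have := X.2.mem ha
    rwa [add_zero] at this
  suffices h : ∀ β, GradedManifold.HasFnDerivAt (fun τ => QManifold.fStar (ρ.comp (Φ τ)) β)
    (δ β) t from h α
  intro β
  induction β using Form.induction_left with
  | one =>
    simp only [map_one, h1]
    exact .const _ _
  | add α β hα hβ => simpa only [map_add] using hα.add hβ
  | smul r β hβ => simpa only [map_smul] using hβ.smul r
  | fn_mul i h β hβ =>
    rw [h2]
    simp only [map_mul, QManifold.fStar_fn]
    have hh : ρ.pullTop h.1 ∈ M.Homog i := ρ.pull_mem _ h.2
    exact GradedManifold.HasFnDerivAt.mul (i := i) (fun τ => (Φ τ).pull_mem _ hh)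
      ((Φ t).pull_mem _ (hXmem hh)) (hpull t ht _) hβ
  | dfn_mul i h β hβ =>
    rw [h3]
    simp only [map_mul, QManifold.fStar_dfn]
    have hh : ρ.pullTop h.1 ∈ M.Homog i := ρ.pull_mem _ h.2
    have hh' : ρ.pullTop (M₂.Q.1 ⊤ h.1) ∈ M.Homog (i + 1) := ρ.pull_mem _ (M₂.Q.2.mem h.2)
    refine GradedManifold.HasFnDerivAt.mul (i := i + 1)
      (fun τ => QManifold.fieldStrength_mem _ h.2)
      (sub_mem (M₁.Q.2.mem ((Φ t).pull_mem _ (hXmem hh))) ((Φ t).pull_mem _ (hXmem hh'))) ?_ hβ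
    -- The two halves of the field strength: for `Q₁ φ_τ^*` the derivative is exchanged with `Q₁`,
    -- using joint smoothness of the family; for `φ_τ^* Q` the evolution equation applies directly
    -- to `ρ^*(Q₂ h)`.
    exact (GradedManifold.HasFnDerivAt.vf_apply hJ
      (g := fun τ => (Φ τ).pullTop (ρ.pullTop h.1))
      (g' := fun τ => (Φ τ).pullTop (X.1 ⊤ (ρ.pullTop h.1))) (hX'.smooth _)
      (fun τ hτ => hpull τ hτ _) M₁.Q ht).sub (hpull t ht _)

end TrivialBundle

/-! ### Global functions determine morphisms. -/

/-- The exponents of the empty monomial. -/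
def MultiIndex.zero {r : ℕ} (d : Fin r → ℤ) : MultiIndex d := ⟨0, by simp⟩

namespace GradedSpace.IsCoord

variable {M : GradedSpace.{u}} {U : Opens M.Body} {r : ℕ} {d : Fin r → ℤ} {ξ : Fin r → M.fn U}

theorem coeffAt_ofSmooth (hξ : IsCoord U d ξ) (s : M.Sm U) (x : U) :
    hξ.coeffAt (MultiIndex.zero d) x (M.ofSmooth U s) = s x := by
  have : hξ.coeff (M.ofSmooth U s) = Finsupp.single (MultiIndex.zero d) s := by
    refine hξ.coeff_unique ?_
    rw [Finsupp.sum_single_index (by simp)]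
    simp [monomial, MultiIndex.zero]
  rw [coeffAt_apply, this, Finsupp.single_eq_same]

end GradedSpace.IsCoord

namespace GradedManifold

variable {N : GradedManifold.{u}}

/-- Injectivity follows from uniqueness of expansions: a body function is its own coefficient at the
empty monomial. -/
theorem ofSmooth_injective : Function.Injective (N.ofSmooth ⊤) := by
  intro c c' h
  refine ContMDiffMap.ext fun x => ?_
  obtain ⟨U, hxU, ξ, hξ⟩ := N.exists_coord x.1
  have h1 := congrArg (fun a => hξ.coeffAt (MultiIndex.zero _) ⟨x.1, hxU⟩ (N.res le_top a)) h
  simp only [N.res_ofSmooth, hξ.coeffAt_ofSmooth] at h1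
  exact h1

/-- Smooth functions separate the points of the body. -/
theorem exists_smooth_ne {y z : N.Body} (h : y ≠ z) :
    ∃ c : N.Sm ⊤, c ⟨y, Opens.mem_top y⟩ ≠ c ⟨z, Opens.mem_top z⟩ := by
  obtain ⟨χ, -, hχ⟩ := (SmoothBumpFunction.nhds_basis_support (I := 𝓡 N.dim) (c := y)
    Filter.univ_mem).mem_iff.1 (isOpen_compl_singleton.mem_nhds h)
  refine ⟨⟨fun x => χ x.1, χ.contMDiff.comp contMDiff_subtype_val⟩, ?_⟩
  change χ y ≠ χ z
  have hz : χ z = 0 := Function.notMem_support.1 fun hz => hχ hz rfl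
  rw [χ.eq_one, hz]
  exact one_ne_zero

/-- Near a given point, every local function is the restriction of a global one. -/
theorem exists_global_extension {U : Opens N.Body} (a : N.fn U) {y : N.Body} (hy : y ∈ U) :
    ∃ (W : Opens N.Body) (hW : W ≤ U) (b : N.Fn), y ∈ W ∧ N.res le_top b = N.res hW a := by
  obtain ⟨χ, -, hχ⟩ := (SmoothBumpFunction.nhds_basis_tsupport (I := 𝓡 N.dim) y).mem_iff.1
    (U.isOpen.mem_nhds hy)
  obtain ⟨W₀, hW₀, hW₀o, hyW₀⟩ := eventually_nhds_iff.1 χ.eventuallyEq_one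
  let W : Opens N.Body := ⟨W₀, hW₀o⟩ ⊓ U
  refine ⟨W, inf_le_right, ?_⟩
  suffices h : ∃ b : N.Fn, N.res le_top b = N.res (inf_le_right : W ≤ U) a by
    obtain ⟨b, hb⟩ := h
    exact ⟨b, ⟨hyW₀, hy⟩, hb⟩
  -- Sections of a single degree can be glued, so the homogeneous components are extended
  -- separately, all with the same cut-off and the same `W`.
  refine Submodule.iSup_induction (motive := fun a => ∃ b : N.Fn,
    N.res le_top b = N.res (inf_le_right : W ≤ U) a) (N.grading U) (x := a) ?_ ?_
    ⟨0, by simp⟩ ?_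
  · rw [(N.isInternal U).submodule_iSup_eq_top]
    trivial
  · intro k a ha
    let c : N.Sm U := ⟨fun x => χ x.1, χ.contMDiff.comp contMDiff_subtype_val⟩
    let V : Opens N.Body := ⟨(tsupport χ)ᶜ, (isClosed_tsupport χ).isOpen_compl⟩
    -- The cover by `U` and the complement of the closed support of `χ`: `χ a` on the former and
    -- zero on the latter agree on overlaps, and the glued function restricts to `a` on `W`, where
    -- `χ = 1`.
    let C : ULift.{u} Bool → Opens N.Body := fun i => cond i.down U V
    let s : ∀ i, N.fn (C i)
      | ⟨true⟩ => N.ofSmooth U c * a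
      | ⟨false⟩ => 0
    have hs0 : ∀ (O : Opens N.Body) (h : O ≤ U), O ≤ V → N.res h (N.ofSmooth U c * a) = 0 := by
      intro O h hO
      rw [map_mul, N.res_ofSmooth]
      have : ContMDiffMap.restrictRingHom (n := ∞) (𝓡 N.dim) 𝓘(ℝ, ℝ) ℝ h c = 0 :=
        ContMDiffMap.ext fun x =>
          (image_eq_zero_of_notMem_tsupport (f := χ) (hO x.2) : χ x.1 = 0)
      rw [this, map_zero, zero_mul]
    obtain ⟨t, -, ht⟩ := N.glue C k s
      (by
        rintro ⟨_ | _⟩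
        · exact zero_mem _
        · have := N.mul_mem (N.ofSmooth_mem c) ha
          rwa [zero_add] at this)
      (by
        rintro ⟨_ | _⟩ ⟨_ | _⟩
        · simp [s]
        · exact (map_zero _).trans (hs0 _ _ inf_le_left).symm
        · exact (hs0 _ _ inf_le_right).trans (map_zero _).symm
        · rfl)
    have htop : ⊤ ≤ iSup C := by
      intro x _
      by_cases hx : x ∈ tsupport χ
      · exact le_iSup C ⟨true⟩ (hχ hx)
      · exact le_iSup C ⟨false⟩ hx
    refine ⟨N.res htop t, ?_⟩
    have hWU : W ≤ U := inf_le_right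
    have h1 := congrArg (N.res hWU) (ht ⟨true⟩)
    have h2 : N.res hWU (N.ofSmooth U c * a) = N.res hWU a := by
      rw [map_mul, N.res_ofSmooth]
      have : ContMDiffMap.restrictRingHom (n := ∞) (𝓡 N.dim) 𝓘(ℝ, ℝ) ℝ hWU c = 1 :=
        ContMDiffMap.ext fun x => hW₀ x.1 x.2.1
      rw [this, map_one, one_mul]
    rw [N.res_res]
    exact ((N.res_res _ _ t).symm.trans h1).trans h2
  · rintro x y ⟨b, hb⟩ ⟨b', hb'⟩
    exact ⟨b + b', by rw [map_add, map_add, hb, hb']⟩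

end GradedManifold

namespace GMor

variable {L M N : GradedManifold.{u}}

/-- A morphism of graded manifolds is determined by the pull-back of global functions. -/
theorem ext_pullTop {φ ψ : GMor M N} (h : ∀ a : N.Fn, φ.pullTop a = ψ.pullTop a) : φ = ψ := by
  have hb : φ.base = ψ.base := by
    funext x
    by_contra hne
    obtain ⟨c, hc⟩ := GradedManifold.exists_smooth_ne hne
    have h1 : M.ofSmooth ⊤ (φ.pullSmTop c) = M.ofSmooth ⊤ (ψ.pullSmTop c) := by
      have h2 := congrArg Subtype.val (φ.pullHom_smooth c)
      have h3 := congrArg Subtype.val (ψ.pullHom_smooth c)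
      exact h2.symm.trans ((h _).trans h3)
    have h4 := GradedManifold.ofSmooth_injective h1
    exact hc (congrArg (fun s : M.Sm ⊤ => s ⟨x, Opens.mem_top x⟩) h4)
  -- Equality can be tested locally, and near `φ(x)` the function `a` is the restriction of a global
  -- `b`, on whose pull-back both morphisms agree.
  have hp : ∀ U V hφ hψ a, φ.pull U V hφ a = ψ.pull U V hψ a := by
    intro U V hφ hψ a
    rw [← sub_eq_zero]
    refine M.separated _ fun x hx => ?_
    obtain ⟨W, hW, b, hxW, hWb⟩ := GradedManifold.exists_global_extension a (hφ x hx)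
    have loc : ∀ (χ : GMor M N) (hχ : ∀ x ∈ V, χ.base x ∈ U) (V' : Opens M.Body) (h' : V' ≤ V),
        (∀ x ∈ V', χ.base x ∈ W) → M.res h' (χ.pull U V hχ a) = M.res le_top (χ.pullTop b) := by
      intro χ hχ V' h' hV'
      rw [χ.res_pull h' hχ (fun x hx => hχ x (h' hx)), ← χ.pull_res hW hV', ← hWb,
        χ.pull_res _ _ (fun _ _ => Opens.mem_top _), pullTop, χ.res_pull]
    have hψW : ∀ x ∈ V ⊓ φ.pre W, ψ.base x ∈ W := fun x hx => by
      rw [← hb]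
      exact hx.2
    refine ⟨V ⊓ φ.pre W, inf_le_left, ⟨hx, hxW⟩, ?_⟩
    rw [map_sub, loc φ hφ (V ⊓ φ.pre W) inf_le_left fun x hx => hx.2, loc ψ hψ _ _ hψW, h, sub_self]
  refine GMor.ext hb ?_
  cases φ
  cases ψ
  cases hb
  exact heq_of_eq (funext fun U => funext fun V => funext fun h => AlgHom.ext (hp U V h h))

/-- Coefficients of a pull-back in terms of the coefficients of the function. -/
theorem coeffAt_pullTop (φ : GMor L M) {U : Opens L.Body} {ξ : Fin L.rank → L.fn U}
    (hξ : GradedSpace.IsCoord U L.deg ξ) {U' : Opens M.Body} {ξ' : Fin M.rank → M.fn U'}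
    (hξ' : GradedSpace.IsCoord U' M.deg ξ') {V : Opens L.Body} (hV : V ≤ U)
    (hV' : ∀ x ∈ V, φ.base x ∈ U') (I : MultiIndex L.deg) (y : V) (a : M.Fn) :
    hξ.coeffAt I ⟨y.1, hV y.2⟩ (L.res le_top (φ.pullTop a)) =
      ∑ K ∈ hξ'.indices I.degree, hξ'.coeffAt K ⟨φ.base y.1, hV' y.1 y.2⟩ (M.res le_top a) *
        (hξ.restrict hV).coeffAt I y (φ.pull U' V hV' (GradedSpace.monomial ξ' K)) := by
  have h1 : L.res hV (L.res le_top (φ.pullTop a)) = φ.pull U' V hV' (M.res le_top a) := by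
    rw [L.res_res, pullTop, φ.res_pull _ _ (fun _ _ => Opens.mem_top _), φ.pull_res]
  rw [← hξ.coeffAt_res hV, h1]
  -- Pull-back preserves degrees, so monomials of degree above that of `I` cannot contribute to the
  -- coefficient at `I`.
  have h2 := hξ'.apply_eq_sum_indices
    ((hξ.restrict hV).coeffAt I y ∘ₗ (φ.pull U' V hV').toLinearMap) I.degree
    (fun k hk b hb => (hξ.restrict hV).coeffAt_eq_zero_of_mem (φ.pull_mem _ hb) (by omega) y)
    (M.res le_top a)
  refine h2.trans (Finset.sum_congr rfl fun K _ => ?_)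
  simp only [LinearMap.comp_apply, AlgHom.toLinearMap_apply, map_mul]
  rw [φ.pull_ofSmooth hV' _ (φ.pullSm hV' _) fun _ => rfl,
    (hξ.restrict hV).coeffAt_ofSmooth_mul]
  rfl

end GMor

/-! ### Integral families composed with a fixed morphism. -/

/-- The composition of an integral family with a fixed morphism is an integral family. -/
theorem IsIntegralFamily.comp {L N M : GradedManifold.{u}} {J : Set ℝ} (hJ : IsOpen J)
    {Φ : ℝ → GMor N M} {X : VF M 0} (hΦ : IsIntegralFamily J Φ X) (φ : GMor L N) :
    IsIntegralFamily J (fun t => (Φ t).comp φ) X where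
  smooth h U ξ hξ I := by
    rintro ⟨t, x⟩ ⟨ht, -⟩
    obtain ⟨U', hxU', ξ', hξ'⟩ := N.exists_coord (φ.base x.1)
    have hV : U ⊓ φ.pre U' ≤ U := inf_le_left
    have hV' : ∀ x ∈ U ⊓ φ.pre U', φ.base x ∈ U' := fun _ hx => hx.2
    -- The open set of parameters and points whose image lies in the coordinate domain `U'`.
    -- Smoothness is local, and over `O` the coefficients have a finite expansion in those of `Φ t`.
    let O : Opens (ℝ × U) := ⟨{p | p.1 ∈ J ∧ φ.base p.2.1 ∈ U'},
      (hJ.preimage continuous_fst).inter (U'.isOpen.preimage (φ.contMDiff_base.continuous.comp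
        (continuous_subtype_val.comp continuous_snd)))⟩
    have hO : ContMDiff (𝓘(ℝ, ℝ).prod (𝓡 L.dim)) (𝓘(ℝ, ℝ).prod (𝓡 L.dim)) ∞
        (Subtype.val : O → ℝ × U) := contMDiff_subtype_val
    have hx2 : ContMDiff (𝓘(ℝ, ℝ).prod (𝓡 L.dim)) (𝓡 L.dim) ∞ fun q : O => q.1.2.1 :=
      contMDiff_subtype_val.comp (contMDiff_snd.comp hO)
    have hq : ContMDiff (𝓘(ℝ, ℝ).prod (𝓡 L.dim)) (𝓡 L.dim) ∞
        (fun q : O => (⟨q.1.2.1, q.1.2.2, q.2.2⟩ : (U ⊓ φ.pre U' : Opens L.Body))) :=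
      (ContMDiff.subtypeVal_comp_iff _ _).1 hx2
    have hq' : ContMDiff (𝓘(ℝ, ℝ).prod (𝓡 L.dim)) (𝓘(ℝ, ℝ).prod (𝓡 N.dim)) ∞
        (fun q : O => (q.1.1, (⟨φ.base q.1.2.1, q.2.2⟩ : U'))) :=
      (contMDiff_fst.comp hO).prodMk
        ((ContMDiff.subtypeVal_comp_iff _ _).1 (φ.contMDiff_base.comp hx2))
    refine ContMDiffAt.contMDiffWithinAt ?_
    refine (contMDiffAt_subtype_iff (U := O) (x := ⟨(t, x), ht, hxU'⟩)).1 ?_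
    have key : (fun q : O => hξ.coeff (L.res le_top (((Φ q.1.1).comp φ).pullTop h)) I q.1.2) =
        fun q : O => ∑ K ∈ hξ'.indices I.degree,
          hξ'.coeff (N.res le_top ((Φ q.1.1).pullTop h)) K ⟨φ.base q.1.2.1, q.2.2⟩ *
            (hξ.restrict hV).coeff (φ.pull U' _ hV' (GradedSpace.monomial ξ' K)) I
              ⟨q.1.2.1, q.1.2.2, q.2.2⟩ := by
      funext q
      exact φ.coeffAt_pullTop hξ hξ' hV hV' I ⟨q.1.2.1, q.1.2.2, q.2.2⟩ _
    rw [key]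
    refine ContMDiff.contMDiffAt ?_
    refine contMDiff_finsetSum fun K _ => ?_
    refine ContMDiff.mul ?_ ?_
    · exact (hΦ.smooth h U' ξ' hξ' K).comp_contMDiff hq' fun q => ⟨q.2.1, trivial⟩
    · exact ContMDiff.comp (ContMDiffMap.contMDiff _) hq
  hasDerivAt h U ξ hξ I t ht x := by
    obtain ⟨U', hxU', ξ', hξ'⟩ := N.exists_coord (φ.base x.1)
    have key := φ.coeffAt_pullTop hξ hξ' (V := U ⊓ φ.pre U') inf_le_left (fun _ hx => hx.2) I
      ⟨x.1, x.2, hxU'⟩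
    -- The expansion is linear in the coefficients of `Φ τ`, and the other factors depend only on
    -- `φ`, so it can be differentiated term by term.
    refine HasDerivAt.congr_deriv (HasDerivAt.congr_of_eventuallyEq (HasDerivAt.fun_sum
      fun K _ => (hΦ.hasDerivAt h U' ξ' hξ' K t ht ⟨φ.base x.1, hxU'⟩).mul_const _)
      (Filter.Eventually.of_forall fun τ => key ((Φ τ).pullTop h))) ?_
    exact (key ((Φ t).pullTop (X.1 ⊤ h))).symm

/-! ### Gauge flows act on sections. -/

section TrivialBundle

variable {M₁ M₂ M : QManifold.{u}} {π : GMor M.toGradedManifold M₁.toGradedManifold}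
  {ρ : GMor M.toGradedManifold M₂.toGradedManifold} {G : HolonomyAlgebra M₂}

/-- Infinitesimal gauge transformations are vertical. -/
theorem gaugeAlgebra_apply_pullTop (hπ : IsQMorphism π) {X : VF M.toGradedManifold 0}
    (hX : X ∈ gaugeAlgebra π ρ G) (a : M₁.Fn) : X.1 ⊤ (π.pullTop a) = 0 := by
  obtain ⟨Z, hZ, hXZ⟩ := hX
  have hZ0 : ∀ a : M₁.Fn, Z.1 ⊤ (π.pullTop a) = 0 := by
    clear hXZ
    induction hZ using Submodule.span_induction with
    | zero => intro a; rfl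
    | add x y _ _ hx hy =>
      intro a
      simp [hx, hy]
    | smul r x _ hx =>
      intro a
      simp [hx]
    | mem Z hZ =>
      obtain ⟨i, j, b, Y, Y', -, -, hY, hZ⟩ := hZ
      intro a
      have h0 : Y'.1 ⊤ (π.pullTop a) = 0 := hY.fst _ _ _ a
      rw [hZ, h0, mul_zero]
  -- `Q` sends `π^* a` to `π^*(Q₁ a)`, which `Z` kills as well, so both halves of the bracket
  -- vanish.
  have hQ : M.Q.1 ⊤ (π.pullTop a) = π.pullTop (M₁.Q.1 ⊤ a) := hπ _ _ _ a
  rw [hXZ, VF.bracket_apply, hQ, hZ0, hZ0, map_zero, smul_zero, sub_zero]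

/-- The derivative of `Ψ_t^* π^* a` is `Ψ_t^*(X π^* a) = 0`, so `Ψ_t^* π^* a` keeps its value `π^*
a` at time zero; global functions then determine `π ∘ Ψ_t`. -/
theorem comp_flow_eq (hπ : IsQMorphism π) {X : VF M.toGradedManifold 0}
    (hX : X ∈ gaugeAlgebra π ρ G) {Ψ : ℝ → GMor M.toGradedManifold M.toGradedManifold}
    (hΨ : IsFlow X Ψ) (t : ℝ) : π.comp (Ψ t) = π := by
  refine GMor.ext_pullTop fun a => ?_
  have h0 : (Ψ 0).pullTop (π.pullTop a) = π.pullTop a := by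
    rw [hΨ.zero]
    exact M.res_self _
  rw [GMor.pullTop_comp]
  refine (GradedManifold.HasFnDerivAt.eq_of_zero (g := fun τ => (Ψ τ).pullTop (π.pullTop a))
    isOpen_univ Set.ordConnected_univ (fun t _ U ξ hξ I x => ?_) (Set.mem_univ t)
    (Set.mem_univ 0)).trans h0
  have := hΨ.isIntegralFamily.hasDerivAt (π.pullTop a) U ξ hξ I t (Set.mem_univ t) x
  rw [gaugeAlgebra_apply_pullTop hπ hX, map_zero] at this
  exact this

theorem isSection_flow_comp (hπ : IsQMorphism π) {X : VF M.toGradedManifold 0}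
    (hX : X ∈ gaugeAlgebra π ρ G) {Ψ : ℝ → GMor M.toGradedManifold M.toGradedManifold}
    (hΨ : IsFlow X Ψ) {φ : GMor M₁.toGradedManifold M.toGradedManifold} (hφ : IsSection π φ)
    (t : ℝ) : IsSection π ((Ψ t).comp φ) := by
  change (π.comp (Ψ t)).comp φ = GMor.id _
  rw [comp_flow_eq hπ hX hΨ]
  exact hφ

end TrivialBundle

/-! ### Invariance under the group and along integral families. -/

theorem mainTheorem4 {M₁ M₂ M : QManifold.{u}}
    (π : GMor M.toGradedManifold M₁.toGradedManifold)
    (ρ : GMor M.toGradedManifold M₂.toGradedManifold) (hM : IsTrivialQBundle π ρ)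
    (G : HolonomyAlgebra M₂) (α : Form M₂.toGradedManifold) (hα : G.IsBasic α) :
    (∀ φ : GMor M₁.toGradedManifold M.toGradedManifold, IsSection π φ →
      ∀ Ψ : GMor M.toGradedManifold M.toGradedManifold, ExpGroup (gaugeAlgebra π ρ G) Ψ →
        IsSection π (Ψ.comp φ) ∧
        QManifold.fStar (Ψ.comp φ) (ρ.pullForm α) = QManifold.fStar φ (ρ.pullForm α)) ∧
    (∀ X ∈ gaugeAlgebra π ρ G, ∀ J : Set ℝ, IsOpen J → J.OrdConnected →
      ∀ Φ : ℝ → GMor M₁.toGradedManifold M.toGradedManifold,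
        (∀ t ∈ J, IsSection π (Φ t)) → IsIntegralFamily J Φ X →
        ∀ s ∈ J, ∀ t ∈ J,
          QManifold.fStar (Φ s) (ρ.pullForm α) = QManifold.fStar (Φ t) (ρ.pullForm α)) := by
  refine ⟨fun φ hφ Ψ hΨ => ?_, fun X hX J hJ hJ' Φ hΦ hΦX s hs t ht =>
    fStar_eq_of_isIntegralFamily hM hα hX hJ hJ' hΦ hΦX hs ht⟩
  -- The section must vary: for a product, the outer factor acts on the section `Ψ' ∘ φ`.
  induction hΨ generalizing φ with
  | @exp X Ψ hX hΨ =>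
    refine ⟨isSection_flow_comp hM.isQMorphism_fst hX hΨ hφ 1, ?_⟩
    -- Constancy of `f^*` along `Ψ_t ∘ φ` on the whole line, read at times one and zero; `Ψ_0` is
    -- the identity.
    have h := fStar_eq_of_isIntegralFamily hM hα hX isOpen_univ Set.ordConnected_univ
      (fun t _ => isSection_flow_comp hM.isQMorphism_fst hX hΨ hφ t)
      (hΨ.isIntegralFamily.comp isOpen_univ φ) (Set.mem_univ 1) (Set.mem_univ 0)
    have h0 : (GMor.id M.toGradedManifold).comp φ = φ := by
      refine GMor.ext_pullTop fun a => ?_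
      rw [GMor.pullTop_comp]
      exact congrArg _ (M.res_self a)
    rwa [hΨ.zero, h0] at h
  | @comp Ψ Ψ' _ _ ih ih' =>
    obtain ⟨h1, h2⟩ := ih' φ hφ
    obtain ⟨h3, h4⟩ := ih (Ψ'.comp φ) h1
    exact ⟨h3, h4.trans h2⟩
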